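/- All vector spaces are real. A map between open subsets of Banach spaces is of class $C^{k,\alpha}_{\rm loc}$ ($k\in\mathbb N_0\cup\{\infty\}$, $\alpha\in[0,1]$) if it is $C^k$ and, when $k<\infty$, its $k$-th derivative is $\alpha$-Hölder continuous near every point. Banach manifolds (charts with values in possibly different Banach spaces) and Banach bundles (transition maps regarded as maps into spaces of bounded operators) of class $C^{k,\alpha}_{\rm loc}$ are understood accordingly, as are maps between such manifolds and bundle morphisms. A *para-Hilbert space* $E$ consists of Banach spaces $X_E$, $Y_E$, a Hilbert space $H_E$ with inner product $\langle\cdot,\cdot\rangle_{H_E}$ and Riesz isomorphism $I_E\colon H_E\to H_E'$, continuous linear injections $i_E\colon X_E\to H_E$ and $j_E\colon H_E\to Y_E$ with dense images, and an isomorphism $J_E\colon X_E\to Y_E'$ of Banach spaces with $I_E\, i_E=j_E'\,J_E$. A *morphism* $A\colon E_1\to E_2$ is a triple $(X_A,H_A,Y_A)$ of bounded operators on the three scales commuting with $i$ and $j$; it is *surjective* if all three operators are. A *pseudoinverse* of $A$ is a morphism $B\colon E_2\to E_1$ with $ABA=A$ and $BAB=B$ for which $H_{A}H_{B}$ and $H_{B}H_{A}$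 are self-adjoint. A *para-Hilbert bundle* of class $C^{l,\alpha}_{\rm loc}$ over a Banach manifold consists of Banach bundles $X_E,H_E,Y_E$ and bundle morphisms $i_E,j_E,I_E,J_E$, all of class $C^{l,\alpha}_{\rm loc}$, that form a para-Hilbert space in every fibre. Let $k\in\{1,2,\dots\}\cup\{\infty\}$. A *para-Riemannian manifold* $(M,E)$ of class $C^{k,\alpha}_{\rm loc}$ is a Banach manifold $M$ of class $C^{k,\alpha}_{\rm loc}$ with a para-Hilbert bundle $E$ of class $C^{k-1,\alpha}_{\rm loc}$ over $M$ such that $X_E=TM$. A *morphism* $(M_1,E_1)\to(M_2,E_2)$ of class $C^{k,\alpha}_{\rm loc}$ is a $C^{k,\alpha}_{\rm loc}$ map $F\colon M_1\to M_2$ together with a fibrewise morphism $A\colon E_1\to E_2$ over $F$ of class $C^{k-1,\alpha}_{\rm loc}$ with $X_A=TF$. **Theorem.** Let $k\in\{1,2,\dots\}\cup\{\infty\}$ and $\alpha\in[0,1]$. Let $\Phi\colon M_1\to M_2$ be a morphism of class $C^{k,\alpha}_{\rm loc}$ between para-Riemannian manifolds $(M_1,E_1)$ and $(M_2,E_2)$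 of class $C^{k,\alpha}_{\rm loc}$, with induced bundle morphism $A=(T\Phi,H_\Phi,Y_\Phi)\colon E_1\to E_2$. Let $y_0\in M_2$ and $M_0:=\Phi^{-1}(\{y_0\})\subset M_1$, and suppose that for each $x\in M_0$ the morphism $A_x$ is surjective and admits a pseudoinverse. Put $E_0:=\ker(A)|_{M_0}=(\ker X_A,\ker H_A,\ker Y_A)|_{M_0}$ and, for $x\in M_0$, $$\langle I_{E_0}|_x v_1,v_2\rangle:=\langle I_{E_1}|_x v_1,v_2\rangle\quad (v_1,v_2\in H_{E_0}|_x),\qquad \langle J_{E_0}|_x u,w\rangle:=\langle J_{E_1}|_x u,w\rangle\quad (u\in X_{E_0}|_x,\ w\in Y_{E_0}|_x).$$ Then $(M_0,E_0)$ is a para-Riemannian manifold of class $C^{k,\alpha}_{\rm loc}$. More precisely, $M_0$ with the subspace topology carries a structure of Banach manifold of class $C^{k,\alpha}_{\rm loc}$, and $E_0$ with $I_{E_0}$, $J_{E_0}$ a structure of para-Hilbert bundle of class $C^{k-1,\alpha}_{\rm loc}$ with $X_{E_0}=TM_0$, such that the inclusion $M_0\to M_1$, with the fibrewise inclusions $E_0\to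 E_1$, is a morphism of para-Riemannian manifolds of class $C^{k,\alpha}_{\rm loc}$. -/

import Mathlib

open scoped NNReal Topology

universe u v

/-- Near the point `x`, the map `f` is of class `C^{k,α}_loc`: it is `k` times continuously
differentiable and, if `k` is finite, its `k`-th derivative is Hölder continuous with exponent `α`
on a neighbourhood of `x`.  For `α = 0` or `k = ∞` this is the class `C^k`. -/
def CkaAt {V W : Type*} [NormedAddCommGroup V] [NormedSpace ℝ V] [NormedAddCommGroup W]
    [NormedSpace ℝ W] (k : ℕ∞) (α : ℝ≥0) (f : V → W) (x : V) : Prop :=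
  ContDiffAt ℝ k f x ∧
    ∀ n : ℕ, k = n → ∃ U ∈ 𝓝 x, ∃ C : ℝ≥0, HolderOnWith C α (iteratedFDeriv ℝ n f) U

/-- A Banach manifold structure of class `C^{k,α}_loc` on the topological space `M`: an atlas of
charts with values in real Banach spaces.  Different charts may have different model spaces. -/
structure BanachManifold (M : Type u) [TopologicalSpace M] (k : ℕ∞) (α : ℝ≥0) where
  ι : Type u
  V : ι → Type u
  [normed : ∀ c, NormedAddCommGroup (V c)]
  [space : ∀ c, NormedSpace ℝ (V c)]
  [complete : ∀ c, CompleteSpace (V c)]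
  chart : ∀ c, OpenPartialHomeomorph M (V c)
  cover : ∀ x, ∃ c, x ∈ (chart c).source
  compat : ∀ c d x, x ∈ (chart c).source → x ∈ (chart d).source →
    CkaAt k α (chart d ∘ (chart c).symm) (chart c x)

attribute [instance] BanachManifold.normed BanachManifold.space BanachManifold.complete

namespace BanachManifold

variable {M : Type u} [TopologicalSpace M] {N : Type v} [TopologicalSpace N] {k : ℕ∞} {α : ℝ≥0}

/-- Near `x`, the function `f` with values in a normed space is of class `C^{l,α}_loc`. -/
def RegAt (𝔐 : BanachManifold M k α) (l : ℕ∞) {W : Type*} [NormedAddCommGroup W]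
    [NormedSpace ℝ W] (f : M → W) (x : M) : Prop :=
  ∀ c, x ∈ (𝔐.chart c).source → CkaAt l α (f ∘ (𝔐.chart c).symm) (𝔐.chart c x)

/-- The map `f` between Banach manifolds is of class `C^{k,α}_loc`. -/
def IsRegularMap (𝔐 : BanachManifold M k α) (𝔑 : BanachManifold N k α) (f : M → N) : Prop :=
  Continuous f ∧ ∀ c d x, x ∈ (𝔐.chart c).source → f x ∈ (𝔑.chart d).source →
    CkaAt k α (𝔑.chart d ∘ f ∘ (𝔐.chart c).symm) (𝔐.chart c x)

/-- The tangent space at `x`.  A tangent vector is a family of vectors, one in the model space of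
each chart around `x`, that is transformed by the derivatives of the changes of charts
(the entries that belong to the charts not containing `x` are set to zero). -/
def TangentSpace (𝔐 : BanachManifold M k α) (x : M) : Submodule ℝ (∀ c, 𝔐.V c) where
  carrier := {v | (∀ c, x ∉ (𝔐.chart c).source → v c = 0) ∧
    ∀ c d, x ∈ (𝔐.chart c).source → x ∈ (𝔐.chart d).source →
      fderiv ℝ (𝔐.chart d ∘ (𝔐.chart c).symm) (𝔐.chart c x) (v c) = v d}
  add_mem' := fun {a b} ha hb =>
    ⟨fun c hc => by simp [ha.1 c hc, hb.1 c hc],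
      fun c d hc hd => by simp [ha.2 c d hc hd, hb.2 c d hc hd]⟩
  zero_mem' := ⟨fun c _ => rfl, fun c d _ _ => by simp⟩
  smul_mem' := fun r a ha =>
    ⟨fun c hc => by simp [ha.1 c hc], fun c d hc hd => by simp [ha.2 c d hc hd]⟩

/-- The differential of the chart `c` at `x`: the representation of tangent vectors in the chart. -/
def dchart (𝔐 : BanachManifold M k α) (c : 𝔐.ι) (x : M) : 𝔐.TangentSpace x →L[ℝ] 𝔐.V c :=
  (ContinuousLinearMap.proj c).comp (𝔐.TangentSpace x).subtypeL

/-- The vector `w` is the image of the tangent vector `v` under the tangent map of `f` at `x`. -/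
def IsTangentImage (𝔐 : BanachManifold M k α) (𝔑 : BanachManifold N k α) (f : M → N) (x : M)
    (v : 𝔐.TangentSpace x) (w : 𝔑.TangentSpace (f x)) : Prop :=
  ∀ c d, x ∈ (𝔐.chart c).source → f x ∈ (𝔑.chart d).source →
    fderiv ℝ (𝔑.chart d ∘ f ∘ (𝔐.chart c).symm) (𝔐.chart c x) (𝔐.dchart c x v) =
      𝔑.dchart d (f x) w

end BanachManifold

/-- The structure of a Banach bundle of class `C^{l,α}_loc` on the family `F` of topological vector
spaces over the Banach manifold `𝔐`: an atlas of local trivializations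
`triv i x : F x → V i` (`x ∈ baseSet i`) with inverses `trivInv i x`, such that the transition maps,
as maps into the Banach spaces of bounded operators, are of class `C^{l,α}_loc`.
(The values of `triv i` and `trivInv i` outside `baseSet i` are irrelevant.) -/
structure BanachBundle {M : Type u} [TopologicalSpace M] {k : ℕ∞} {α : ℝ≥0}
    (𝔐 : BanachManifold M k α) (l : ℕ∞) (F : M → Type u) [∀ x, AddCommGroup (F x)]
    [∀ x, Module ℝ (F x)] [∀ x, TopologicalSpace (F x)] where
  ι : Type u
  V : ι → Type u
  [normed : ∀ i, NormedAddCommGroup (V i)]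
  [space : ∀ i, NormedSpace ℝ (V i)]
  [complete : ∀ i, CompleteSpace (V i)]
  baseSet : ι → Set M
  isOpen_baseSet : ∀ i, IsOpen (baseSet i)
  cover : ∀ x, ∃ i, x ∈ baseSet i
  triv : ∀ i x, F x →L[ℝ] V i
  trivInv : ∀ i x, V i →L[ℝ] F x
  left_inv : ∀ i x, x ∈ baseSet i → ∀ v, trivInv i x (triv i x v) = v
  right_inv : ∀ i x, x ∈ baseSet i → ∀ w, triv i x (trivInv i x w) = w
  compat : ∀ i j x, x ∈ baseSet i → x ∈ baseSet j →
    𝔐.RegAt l (fun y => (triv j y).comp (trivInv i y)) x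

attribute [instance] BanachBundle.normed BanachBundle.space BanachBundle.complete

namespace BanachBundle

variable {M : Type u} [TopologicalSpace M] {k : ℕ∞} {α : ℝ≥0} {𝔐 : BanachManifold M k α} {l : ℕ∞}
  {F : M → Type u} [∀ x, AddCommGroup (F x)] [∀ x, Module ℝ (F x)] [∀ x, TopologicalSpace (F x)]
  {G : M → Type u} [∀ x, AddCommGroup (G x)] [∀ x, Module ℝ (G x)] [∀ x, TopologicalSpace (G x)]
  {N : Type v} [TopologicalSpace N] {𝔑 : BanachManifold N k α}
  {K : N → Type v} [∀ x, AddCommGroup (K x)] [∀ x, Module ℝ (K x)] [∀ x, TopologicalSpace (K x)]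

/-- The family `A x : F x → K (f x)` is a morphism of Banach bundles of class `C^{l,α}_loc` over the
map `f`: in local trivializations, the operators depend on the point in a `C^{l,α}_loc` manner. -/
def IsMorphismOver (B : BanachBundle 𝔐 l F) (B' : BanachBundle 𝔑 l K) (f : M → N)
    (A : ∀ x, F x →L[ℝ] K (f x)) : Prop :=
  ∀ i j x, x ∈ B.baseSet i → f x ∈ B'.baseSet j →
    𝔐.RegAt l (fun y => ((B'.triv j (f y)).comp (A y)).comp (B.trivInv i y)) x

/-- The family `A x : F x → G x` is a morphism of Banach bundles of class `C^{l,α}_loc` over the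
identity. -/
def IsMorphism (B : BanachBundle 𝔐 l F) (B' : BanachBundle 𝔐 l G)
    (A : ∀ x, F x →L[ℝ] G x) : Prop :=
  B.IsMorphismOver B' id A

/-- The family `A x : F x → (G x)'` is a morphism of class `C^{l,α}_loc` into the dual bundle.
The dual bundle is trivialized by the transposes of the inverse trivializations of `G`. -/
def IsMorphismToDual (B : BanachBundle 𝔐 l F) (B' : BanachBundle 𝔐 l G)
    (A : ∀ x, F x →L[ℝ] G x →L[ℝ] ℝ) : Prop :=
  ∀ i j x, x ∈ B.baseSet i → x ∈ B'.baseSet j →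
    𝔐.RegAt l (fun y => ((ContinuousLinearMap.precomp ℝ (B'.trivInv j y)).comp
      (A y)).comp (B.trivInv i y)) x

/-- The family `τ x : F x → T_x M` is a morphism of class `C^{l,α}_loc` into the tangent bundle,
which is trivialized by the differentials of the charts. -/
def IsMorphismToTangent (B : BanachBundle 𝔐 l F) (τ : ∀ x, F x →L[ℝ] 𝔐.TangentSpace x) : Prop :=
  ∀ i c x, x ∈ B.baseSet i → x ∈ (𝔐.chart c).source →
    𝔐.RegAt l (fun y => ((𝔐.dchart c y).comp (τ y)).comp (B.trivInv i y)) x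

end BanachBundle

/-- A para-Hilbert structure on a triple of (Banachable) spaces `X`, `H`, `Y`: continuous dense
injections `i : X → H` and `j : H → Y`, an inner product on `H` whose Riesz map `I : H → H'` is an
isomorphism (so that the inner product induces the topology of `H`, and `H` is a Hilbert space), and
an isomorphism `J : X → Y'` with `I ∘ i = j' ∘ J`. -/
structure ParaHilbertSpace (X H Y : Type*)
    [AddCommGroup X] [Module ℝ X] [TopologicalSpace X]
    [AddCommGroup H] [Module ℝ H] [TopologicalSpace H]
    [AddCommGroup Y] [Module ℝ Y] [TopologicalSpace Y] where
  i : X →L[ℝ] H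
  j : H →L[ℝ] Y
  I : H →L[ℝ] H →L[ℝ] ℝ
  J : X →L[ℝ] Y →L[ℝ] ℝ
  i_injective : Function.Injective i
  i_dense : DenseRange i
  j_injective : Function.Injective j
  j_dense : DenseRange j
  I_symm : ∀ v w, I v w = I w v
  I_pos : ∀ v, v ≠ 0 → 0 < I v v
  I_iso : I.IsInvertible
  J_iso : J.IsInvertible
  comm : ∀ u v, I (i u) v = J u (j v)

section Linear

variable {X₁ H₁ Y₁ X₂ H₂ Y₂ : Type*}
  [AddCommGroup X₁] [Module ℝ X₁] [TopologicalSpace X₁]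
  [AddCommGroup H₁] [Module ℝ H₁] [TopologicalSpace H₁]
  [AddCommGroup Y₁] [Module ℝ Y₁] [TopologicalSpace Y₁]
  [AddCommGroup X₂] [Module ℝ X₂] [TopologicalSpace X₂]
  [AddCommGroup H₂] [Module ℝ H₂] [TopologicalSpace H₂]
  [AddCommGroup Y₂] [Module ℝ Y₂] [TopologicalSpace Y₂]

/-- A morphism of para-Hilbert spaces: a continuous linear chain map. -/
structure ParaHilbertMor (E₁ : ParaHilbertSpace X₁ H₁ Y₁) (E₂ : ParaHilbertSpace X₂ H₂ Y₂) where
  X : X₁ →L[ℝ] X₂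
  H : H₁ →L[ℝ] H₂
  Y : Y₁ →L[ℝ] Y₂
  comm_i : ∀ u, H (E₁.i u) = E₂.i (X u)
  comm_j : ∀ v, Y (E₁.j v) = E₂.j (H v)

namespace ParaHilbertMor

variable {E₁ : ParaHilbertSpace X₁ H₁ Y₁} {E₂ : ParaHilbertSpace X₂ H₂ Y₂}

/-- A morphism is surjective if it is so on each of the three scales. -/
def IsSurjective (A : ParaHilbertMor E₁ E₂) : Prop :=
  Function.Surjective A.X ∧ Function.Surjective A.H ∧ Function.Surjective A.Y

/-- `B` is a generalized inverse of `A`: `A B A = A` and `B A B = B`. -/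
def IsGeneralizedInverse (A : ParaHilbertMor E₁ E₂) (B : ParaHilbertMor E₂ E₁) : Prop :=
  (∀ u, A.X (B.X (A.X u)) = A.X u) ∧ (∀ u, B.X (A.X (B.X u)) = B.X u) ∧
  (∀ v, A.H (B.H (A.H v)) = A.H v) ∧ (∀ v, B.H (A.H (B.H v)) = B.H v) ∧
  (∀ w, A.Y (B.Y (A.Y w)) = A.Y w) ∧ (∀ w, B.Y (A.Y (B.Y w)) = B.Y w)

/-- `B` is a pseudoinverse of `A`: a generalized inverse for which `A B` and `B A` are orthogonal
projectors on the Hilbert scale. -/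
def IsPseudoinverse (A : ParaHilbertMor E₁ E₂) (B : ParaHilbertMor E₂ E₁) : Prop :=
  A.IsGeneralizedInverse B ∧
  (∀ v w, E₂.I (A.H (B.H v)) w = E₂.I v (A.H (B.H w))) ∧
  (∀ v w, E₁.I (B.H (A.H v)) w = E₁.I v (B.H (A.H w)))

end ParaHilbertMor

end Linear

/-- A para-Hilbert bundle of class `C^{l,α}_loc` with fibres `X x`, `H x`, `Y x`. -/
structure ParaHilbertBundle {M : Type u} [TopologicalSpace M] {k : ℕ∞} {α : ℝ≥0}
    (𝔐 : BanachManifold M k α) (l : ℕ∞) (X H Y : M → Type u)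
    [∀ x, AddCommGroup (X x)] [∀ x, Module ℝ (X x)] [∀ x, TopologicalSpace (X x)]
    [∀ x, AddCommGroup (H x)] [∀ x, Module ℝ (H x)] [∀ x, TopologicalSpace (H x)]
    [∀ x, AddCommGroup (Y x)] [∀ x, Module ℝ (Y x)] [∀ x, TopologicalSpace (Y x)] where
  bX : BanachBundle 𝔐 l X
  bH : BanachBundle 𝔐 l H
  bY : BanachBundle 𝔐 l Y
  fib : ∀ x, ParaHilbertSpace (X x) (H x) (Y x)
  regular_i : bX.IsMorphism bH fun x => (fib x).i
  regular_j : bH.IsMorphism bY fun x => (fib x).j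
  regular_I : bH.IsMorphismToDual bH fun x => (fib x).I
  regular_J : bX.IsMorphismToDual bY fun x => (fib x).J

/-- A para-Riemannian manifold of class `C^{k,α}_loc`: a Banach manifold of class `C^{k,α}_loc` with
a para-Hilbert bundle of class `C^{k-1,α}_loc` whose bundle `X` is identified with the tangent bundle
by the bundle isomorphism `τ`. -/
structure ParaRiemannianManifold (M : Type u) [TopologicalSpace M] (k : ℕ∞) (α : ℝ≥0)
    (X H Y : M → Type u)
    [∀ x, AddCommGroup (X x)] [∀ x, Module ℝ (X x)] [∀ x, TopologicalSpace (X x)]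
    [∀ x, AddCommGroup (H x)] [∀ x, Module ℝ (H x)] [∀ x, TopologicalSpace (H x)]
    [∀ x, AddCommGroup (Y x)] [∀ x, Module ℝ (Y x)] [∀ x, TopologicalSpace (Y x)] where
  mfd : BanachManifold M k α
  E : ParaHilbertBundle mfd (k - 1) X H Y
  τ : ∀ x, X x ≃L[ℝ] mfd.TangentSpace x
  regular_τ : E.bX.IsMorphismToTangent fun x => (τ x : X x →L[ℝ] mfd.TangentSpace x)

section Morphism

variable {M₁ : Type u} [TopologicalSpace M₁] {M₂ : Type v} [TopologicalSpace M₂]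
  {k : ℕ∞} {α : ℝ≥0} {X₁ H₁ Y₁ : M₁ → Type u} {X₂ H₂ Y₂ : M₂ → Type v}
  [∀ x, AddCommGroup (X₁ x)] [∀ x, Module ℝ (X₁ x)] [∀ x, TopologicalSpace (X₁ x)]
  [∀ x, AddCommGroup (H₁ x)] [∀ x, Module ℝ (H₁ x)] [∀ x, TopologicalSpace (H₁ x)]
  [∀ x, AddCommGroup (Y₁ x)] [∀ x, Module ℝ (Y₁ x)] [∀ x, TopologicalSpace (Y₁ x)]
  [∀ x, AddCommGroup (X₂ x)] [∀ x, Module ℝ (X₂ x)] [∀ x, TopologicalSpace (X₂ x)]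
  [∀ x, AddCommGroup (H₂ x)] [∀ x, Module ℝ (H₂ x)] [∀ x, TopologicalSpace (H₂ x)]
  [∀ x, AddCommGroup (Y₂ x)] [∀ x, Module ℝ (Y₂ x)] [∀ x, TopologicalSpace (Y₂ x)]

/-- The map `f` is a morphism of para-Riemannian manifolds of class `C^{k,α}_loc` with the induced
morphism `mor` of para-Hilbert bundles, which is of class `C^{k-1,α}_loc` and extends the tangent map
of `f`. -/
structure ParaRiemannianMor (P₁ : ParaRiemannianManifold M₁ k α X₁ H₁ Y₁)
    (P₂ : ParaRiemannianManifold M₂ k α X₂ H₂ Y₂) (f : M₁ → M₂) where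
  regular : P₁.mfd.IsRegularMap P₂.mfd f
  mor : ∀ x, ParaHilbertMor (P₁.E.fib x) (P₂.E.fib (f x))
  regular_X : P₁.E.bX.IsMorphismOver P₂.E.bX f fun x => (mor x).X
  regular_H : P₁.E.bH.IsMorphismOver P₂.E.bH f fun x => (mor x).H
  regular_Y : P₁.E.bY.IsMorphismOver P₂.E.bY f fun x => (mor x).Y
  tangent : ∀ x u, P₁.mfd.IsTangentImage P₂.mfd f x (P₁.τ x u) (P₂.τ (f x) ((mor x).X u))

end Morphism

/-! Since A_x is surjective, the identity A B A = A for a pseudoinverse B of A_x gives A B = 1 on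
all three scales. Hence each kernel is complemented, with projector 1 - B A.

Fibres (`ParaHilbertMor.ker`). The projector 1 - B A commutes with i and j, so it carries the dense
images of i and j onto dense images in the kernels. It is self-adjoint on H, hence by density its
transposes with respect to J are the projectors on X and Y. An operator into a dual space that
intertwines two projectors in this way restricts to an isomorphism between the range of the one and
the dual of the range of the other (`ContinuousLinearMap.IsInvertible.restrict_dual`). This makes
the restrictions of I and J isomorphisms.

Base (`BanachManifold.IsRegularMap.exists_levelChart`). In charts, let f represent Φ, let T be its
derivative at p and R a right inverse of T. The map G(z) = (z - p) + R(f(z) - f(p) - T(z - p)) has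
derivative 1 at p and satisfies T G(z) = f(z) - f(p). So G is a chart in which the level set is an
open part of ker T.

Bundles (`BanachBundle.IsMorphismOver.exists_subbundleTriv`). The linear analogue g_y = 1 + b(A_y -
A_{x₀}), where A_{x₀} b = 1, satisfies A_{x₀} g_y = A_y and is invertible near x₀. So it maps ker
A_y isomorphically onto ker A_{x₀}. Only A has to depend regularly on the point; pseudoinverses
enter one point at a time.

The analytic input is that the class C^{k,α} is stable under composition (`CkaAt.comp`) and
inversion (`OpenPartialHomeomorph.ckaAt_symm`). For k = 0 a composition needs one factor of class
C^1. This is always available: changes of charts are C^1 because k ≥ 1, and the operations on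
operators are smooth. -/

open Set Filter

/-! ### Local Hölder continuity and the class `C^{k,α}_loc` -/

/-- The map `f` is Hölder continuous with exponent `α` on a neighbourhood of `x`. -/
def HolderNear {X Y : Type*} [PseudoEMetricSpace X] [PseudoEMetricSpace Y] (α : ℝ≥0) (f : X → Y)
    (x : X) : Prop :=
  ∃ U ∈ 𝓝 x, ∃ C : ℝ≥0, HolderOnWith C α f U

namespace HolderNear

variable {X Y Z : Type*} [PseudoEMetricSpace X] [PseudoEMetricSpace Y] [PseudoEMetricSpace Z]
  {α : ℝ≥0} {f g : X → Y} {x : X}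

theorem congr (hf : HolderNear α f x) (h : f =ᶠ[𝓝 x] g) : HolderNear α g x := by
  obtain ⟨U, hU, C, hC⟩ := hf
  refine ⟨U ∩ {y | f y = g y}, inter_mem hU h, C, fun y hy z hz => ?_⟩
  rw [← hy.2, ← hz.2]
  exact hC y hy.1 z hz.1

/-- Composing two α-Hölder maps only gives the exponent α². The exponent survives if the inner map,
as here, or the outer map, as in `lipschitz_comp`, is locally Lipschitz. -/
theorem comp_lipschitz {g : Y → Z} (hg : HolderNear α g (f x)) (hf : HolderNear 1 f x)
    (hc : ContinuousAt f x) : HolderNear α (g ∘ f) x := by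
  obtain ⟨U, hU, C, hC⟩ := hf
  obtain ⟨W, hW, D, hD⟩ := hg
  refine ⟨U ∩ f ⁻¹' W, inter_mem hU (hc hW), D * C ^ (α : ℝ), ?_⟩
  have := hD.comp (hC.mono (inter_subset_left (t := f ⁻¹' W))) fun y hy => hy.2
  simpa using this

theorem lipschitz_comp {g : Y → Z} (hg : HolderNear 1 g (f x)) (hf : HolderNear α f x)
    (hc : ContinuousAt f x) : HolderNear α (g ∘ f) x := by
  obtain ⟨U, hU, C, hC⟩ := hf
  obtain ⟨W, hW, D, hD⟩ := hg
  refine ⟨U ∩ f ⁻¹' W, inter_mem hU (hc hW), D * C ^ ((1 : ℝ≥0) : ℝ), ?_⟩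
  have := hD.comp (hC.mono (inter_subset_left (t := f ⁻¹' W))) fun y hy => hy.2
  rwa [one_mul] at this

theorem prodMk {g : X → Z} (hf : HolderNear α f x) (hg : HolderNear α g x) :
    HolderNear α (fun y => (f y, g y)) x := by
  obtain ⟨U, hU, C, hC⟩ := hf
  obtain ⟨W, hW, D, hD⟩ := hg
  refine ⟨U ∩ W, inter_mem hU hW, max C D, fun y hy z hz => ?_⟩
  rw [Prod.edist_eq]
  exact max_le ((hC.mono_const (le_max_left C D)) y hy.1 z hz.1)
    ((hD.mono_const (le_max_right C D)) y hy.2 z hz.2)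

theorem pi {ι : Type*} [Fintype ι] {Y : ι → Type*} [∀ i, PseudoEMetricSpace (Y i)]
    {f : X → ∀ i, Y i} (hf : ∀ i, HolderNear α (fun y => f y i) x) : HolderNear α f x := by
  choose U hU C hC using hf
  refine ⟨⋂ i, U i, iInter_mem.2 hU, ∑ i, C i, fun y hy z hz => ?_⟩
  rw [edist_pi_le_iff]
  intro i
  have hi : C i ≤ ∑ i, C i := Finset.single_le_sum (fun _ _ => zero_le) (Finset.mem_univ i)
  exact ((hC i).mono_const hi) y (mem_iInter.1 hy i) z (mem_iInter.1 hz i)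

theorem of_isometry {g : Y → Z} (hg : Isometry g) : HolderNear α (g ∘ f) x ↔ HolderNear α f x := by
  refine exists_congr fun U => and_congr_right fun _ => exists_congr fun C => ?_
  simp only [HolderOnWith, Function.comp_apply, hg.edist_eq]

end HolderNear

/-! ### Calculus in the class C^{k,α} on normed spaces -/

section Normed

variable {V W Z : Type*} [NormedAddCommGroup V] [NormedSpace ℝ V] [NormedAddCommGroup W]
  [NormedSpace ℝ W] [NormedAddCommGroup Z] [NormedSpace ℝ Z]

theorem HasStrictFDerivAt.holderNear {α : ℝ≥0} (hα : α ≤ 1) {f : V → W} {f' : V →L[ℝ] W} {x : V}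
    (hf : HasStrictFDerivAt f f' x) : HolderNear α f x := by
  obtain ⟨K, t, ht, hK⟩ := hf.exists_lipschitzOnWith
  -- Lowering the exponent from 1 to α requires bounded distances; the unit ball has diameter at
  -- most 2.
  refine ⟨t ∩ Metric.closedEBall x 1, inter_mem ht (Metric.closedEBall_mem_nhds x one_pos), _,
    ((holderOnWith_one.2 hK).mono inter_subset_left).of_le (D := 2) (fun y hy z hz => ?_) hα⟩
  calc edist y z ≤ edist y x + edist z x := edist_triangle_right _ _ _
    _ ≤ 1 + 1 := add_le_add hy.2 hz.2
    _ = _ := by norm_num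

theorem ContDiffAt.holderNear {α : ℝ≥0} (hα : α ≤ 1) {f : V → W} {x : V} (hf : ContDiffAt ℝ 1 f x) :
    HolderNear α f x :=
  (hf.hasStrictFDerivAt one_ne_zero).holderNear hα

theorem HolderNear.sum {α : ℝ≥0} (hα : α ≤ 1) {ι : Type*} (s : Finset ι) {f : ι → V → W} {x : V}
    (hf : ∀ i ∈ s, HolderNear α (f i) x) (hc : ∀ i ∈ s, ContinuousAt (f i) x) :
    HolderNear α (fun y => ∑ i ∈ s, f i y) x := by
  classical
  induction s using Finset.induction_on with
  | empty =>
    simp only [Finset.sum_empty]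
    exact contDiffAt_const.holderNear hα
  | insert i s hi ih =>
    simp only [Finset.sum_insert hi]
    have hadd : ContDiff ℝ 1 (fun p : W × W => p.1 + p.2) := by fun_prop
    have h1 := ih (fun j hj => hf j (Finset.mem_insert_of_mem hj))
      fun j hj => hc j (Finset.mem_insert_of_mem hj)
    exact (hadd.contDiffAt.holderNear le_rfl).lipschitz_comp
      ((hf i (Finset.mem_insert_self i s)).prodMk h1)
      ((hc i (Finset.mem_insert_self i s)).prodMk
        (tendsto_finsetSum s fun j hj => hc j (Finset.mem_insert_of_mem hj)))

/-- The uncurried map (q, p) ↦ B q p is analytic, hence locally Lipschitz. This handles the single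
terms of the Faà di Bruno formula. -/
theorem holderNear_uncurry_multilinear {X ι : Type*} [PseudoEMetricSpace X] [Fintype ι] {G : ι → Type*}
    [∀ i, NormedAddCommGroup (G i)] [∀ i, NormedSpace ℝ (G i)]
    (B : W →L[ℝ] ContinuousMultilinearMap ℝ G Z) {α : ℝ≥0} {x : X} {q : X → W} {p : ∀ i, X → G i}
    (hq : HolderNear α q x) (hqc : ContinuousAt q x) (hp : ∀ i, HolderNear α (p i) x)
    (hpc : ∀ i, ContinuousAt (p i) x) :
    HolderNear α (fun y => B (q y) fun i => p i y) x ∧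
      ContinuousAt (fun y => B (q y) fun i => p i y) x := by
  let r : X → W × ∀ i, G i := fun y => (q y, fun i => p i y)
  have hB := (B.analyticOnNhd_uncurry_of_multilinear (r x) (mem_univ _)).hasStrictFDerivAt
  have h1 : HolderNear α r x := hq.prodMk (HolderNear.pi hp)
  have h2 : ContinuousAt r x := hqc.prodMk (continuousAt_pi.2 hpc)
  exact ⟨(hB.holderNear le_rfl).lipschitz_comp (f := r) h1 h2,
    ContinuousAt.comp (f := r) hB.continuousAt h2⟩

namespace CkaAt

variable {k l : ℕ∞} {α : ℝ≥0} {f g : V → W} {x : V}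

theorem holderNear {n : ℕ} (hf : CkaAt n α f x) : HolderNear α (iteratedFDeriv ℝ n f) x :=
  hf.2 n rfl

theorem congr (hf : CkaAt k α f x) (h : f =ᶠ[𝓝 x] g) : CkaAt k α g x := by
  refine ⟨hf.1.congr_of_eventuallyEq h.symm, fun n hn => ?_⟩
  subst hn
  exact hf.holderNear.congr (h.iteratedFDeriv ℝ n)

/-- One more derivative makes the k-th derivative C^1, hence α-Hölder near the point. -/
theorem of_contDiffAt (hα : α ≤ 1) (h : ContDiffAt ℝ (k + 1 : ℕ∞) f x) : CkaAt k α f x := by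
  refine ⟨h.of_le (by exact_mod_cast le_self_add), fun n hn => ?_⟩
  subst hn
  exact (h.iteratedFDeriv_right (m := 1) (i := n) (by push_cast; rw [add_comm])).holderNear hα

theorem mono (hα : α ≤ 1) (hf : CkaAt k α f x) (h : l ≤ k) : CkaAt l α f x := by
  rcases h.eq_or_lt with rfl | h
  · exact hf
  · exact of_contDiffAt hα (hf.1.of_le (by exact_mod_cast Order.add_one_le_of_lt h))

theorem contDiffAt_one (hf : CkaAt k α f x) (hk : 1 ≤ k) : ContDiffAt ℝ 1 f x :=
  hf.1.of_le (by exact_mod_cast hk)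

theorem differentiableAt (hf : CkaAt k α f x) (hk : 1 ≤ k) : DifferentiableAt ℝ f x :=
  (hf.contDiffAt_one hk).differentiableAt one_ne_zero

theorem continuousAt (hf : CkaAt k α f x) : ContinuousAt f x := hf.1.continuousAt

theorem iteratedFDeriv_of_le (hα : α ≤ 1) {n m : ℕ} (hf : CkaAt n α f x) (hm : m ≤ n) :
    HolderNear α (iteratedFDeriv ℝ m f) x ∧ ContinuousAt (iteratedFDeriv ℝ m f) x :=
  ⟨(hf.mono hα (by exact_mod_cast hm)).holderNear,
    hf.1.continuousAt_iteratedFDeriv (by exact_mod_cast hm)⟩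

/-- Composition preserves the class `C^{k,α}_loc` if one of the maps is of class `C^1`. -/
theorem comp (hα : α ≤ 1) {g : W → Z} (hg : CkaAt k α g (f x)) (hf : CkaAt k α f x)
    (h : ContDiffAt ℝ 1 g (f x) ∨ ContDiffAt ℝ 1 f x) : CkaAt k α (g ∘ f) x := by
  refine ⟨hg.1.comp x hf.1, fun n hn => ?_⟩
  subst hn
  change HolderNear α (iteratedFDeriv ℝ n (g ∘ f)) x
  -- Order zero is the only case that needs `h`; for n ≥ 1 both maps are already C^1.
  rcases Nat.eq_zero_or_pos n with rfl | hn
  · have hf0 := hf.holderNear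
    have hg0 := hg.holderNear
    rw [iteratedFDeriv_zero_eq_comp, HolderNear.of_isometry (LinearIsometryEquiv.isometry _)]
      at hf0 hg0 ⊢
    rcases h with h | h
    · exact (h.holderNear le_rfl).lipschitz_comp hf0 hf.continuousAt
    · exact hg0.comp_lipschitz (h.holderNear le_rfl) hf.continuousAt
  have hf1 : ContDiffAt ℝ 1 f x := hf.contDiffAt_one (by exact_mod_cast hn)
  have hev : ∀ᶠ y in 𝓝 x, iteratedFDeriv ℝ n (g ∘ f) y =
      (ftaylorSeries ℝ g (f y)).taylorComp (ftaylorSeries ℝ f y) n := by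
    have h1 := hf.continuousAt.eventually (hg.1.eventually (by simp))
    filter_upwards [hf.1.eventually (by simp), h1] with y hy hy'
    exact iteratedFDeriv_comp hy' hy (by simp)
  refine HolderNear.congr ?_ (EventuallyEq.symm hev)
  -- By Faà di Bruno, the n-th derivative is a finite sum of multilinear expressions in derivatives
  -- of f and in derivatives of g at f, all of order at most n and therefore α-Hölder.
  have hterm (c : OrderedFinpartition n) :
      HolderNear α (fun y => (ftaylorSeries ℝ g (f y)).compAlongOrderedFinpartition
        (ftaylorSeries ℝ f y) c) x ∧
      ContinuousAt (fun y => (ftaylorSeries ℝ g (f y)).compAlongOrderedFinpartition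
        (ftaylorSeries ℝ f y) c) x := by
    have hgl := hg.iteratedFDeriv_of_le hα c.length_le
    have hfl (m) := hf.iteratedFDeriv_of_le hα (c.partSize_le m)
    exact holderNear_uncurry_multilinear (c.compAlongOrderedFinpartitionL ℝ V W Z)
      (hgl.1.comp_lipschitz (hf1.holderNear le_rfl) hf.continuousAt)
      (ContinuousAt.comp (g := iteratedFDeriv ℝ c.length g) hgl.2 hf.continuousAt)
      (fun m => (hfl m).1) fun m => (hfl m).2
  exact HolderNear.sum hα _ (fun c _ => (hterm c).1) fun c _ => (hterm c).2

/-- Sums, compositions and inverses of operators are smooth outer maps, so they preserve the class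
even for k = 0. -/
theorem contDiffAt_comp (hα : α ≤ 1) {g : W → Z} (hg : ∀ n : ℕ∞, ContDiffAt ℝ n g (f x))
    (hf : CkaAt k α f x) : CkaAt k α (g ∘ f) x :=
  comp hα (of_contDiffAt hα (hg _)) hf (Or.inl (hg 1))

theorem contDiff_comp (hα : α ≤ 1) {g : W → Z} (hg : ∀ n : ℕ∞, ContDiff ℝ n g)
    (hf : CkaAt k α f x) : CkaAt k α (g ∘ f) x :=
  hf.contDiffAt_comp hα fun n => (hg n).contDiffAt

theorem of_contDiff (hα : α ≤ 1) (hf : ∀ n : ℕ∞, ContDiff ℝ n f) : CkaAt k α f x :=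
  of_contDiffAt hα (hf _).contDiffAt

theorem prodMk (hf : CkaAt k α f x) {g : V → Z} (hg : CkaAt k α g x) :
    CkaAt k α (fun y => (f y, g y)) x := by
  refine ⟨hf.1.prodMk hg.1, fun n hn => ?_⟩
  subst hn
  have hev : ∀ᶠ y in 𝓝 x, iteratedFDeriv ℝ n (fun y => (f y, g y)) y =
      (iteratedFDeriv ℝ n f y).prod (iteratedFDeriv ℝ n g y) := by
    filter_upwards [hf.1.eventually (by simp), hg.1.eventually (by simp)] with y hy hy'
    exact iteratedFDeriv_prodMk hy hy' (by simp)
  have h := hf.holderNear.prodMk hg.holderNear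
  rw [← HolderNear.of_isometry
    (ContinuousMultilinearMap.prodL ℝ (fun _ : Fin n => V) W Z).isometry] at h
  exact h.congr (EventuallyEq.symm hev)

theorem clm_comp {V' W' Z' : Type*} [NormedAddCommGroup V'] [NormedSpace ℝ V']
    [NormedAddCommGroup W'] [NormedSpace ℝ W'] [NormedAddCommGroup Z'] [NormedSpace ℝ Z']
    (hα : α ≤ 1) {S : V → W' →L[ℝ] Z'} {T : V → V' →L[ℝ] W'}
    (hS : CkaAt k α S x) (hT : CkaAt k α T x) : CkaAt k α (fun y => (S y).comp (T y)) x :=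
  contDiff_comp hα (g := fun p : (W' →L[ℝ] Z') × (V' →L[ℝ] W') => p.1.comp p.2)
    (fun _ => contDiff_fst.clm_comp contDiff_snd) (hS.prodMk hT)

theorem add (hα : α ≤ 1) (hf : CkaAt k α f x) (hg : CkaAt k α g x) :
    CkaAt k α (fun y => f y + g y) x :=
  contDiff_comp hα (g := fun p : W × W => p.1 + p.2)
    (fun _ => contDiff_fst.add contDiff_snd) (hf.prodMk hg)

theorem const (hα : α ≤ 1) (w : W) : CkaAt k α (fun _ : V => w) x :=
  of_contDiff hα fun _ => contDiff_const

theorem sub (hα : α ≤ 1) (hf : CkaAt k α f x) (hg : CkaAt k α g x) :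
    CkaAt k α (fun y => f y - g y) x :=
  contDiff_comp hα (g := fun p : W × W => p.1 - p.2)
    (fun _ => contDiff_fst.sub contDiff_snd) (hf.prodMk hg)

theorem clm_apply (hα : α ≤ 1) (L : W →L[ℝ] Z) (hf : CkaAt k α f x) :
    CkaAt k α (fun y => L (f y)) x :=
  contDiff_comp hα (fun _ => L.contDiff) hf

theorem inverse [CompleteSpace W] (hα : α ≤ 1) {T : V → W →L[ℝ] Z} (hT : CkaAt k α T x)
    (h : (T x).IsInvertible) : CkaAt k α (fun y => (T y).inverse) x :=
  contDiffAt_comp hα (fun _ => h.contDiffAt_map_inverse) hT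

theorem holderNear_iteratedFDeriv_fderiv {n : ℕ} :
    HolderNear α (iteratedFDeriv ℝ n (fderiv ℝ f)) x ↔
      HolderNear α (iteratedFDeriv ℝ (n + 1) f) x := by
  have : iteratedFDeriv ℝ (n + 1) f = (continuousMultilinearCurryRightEquiv' ℝ n V W).symm ∘
      iteratedFDeriv ℝ n (fderiv ℝ f) := funext fun y => iteratedFDeriv_succ_eq_comp_right
  rw [this, HolderNear.of_isometry (LinearIsometryEquiv.isometry _)]

theorem fderiv (hf : CkaAt k α f x) (hk : 1 ≤ k) : CkaAt (k - 1) α (fderiv ℝ f) x := by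
  refine ⟨hf.1.fderiv_right (by exact_mod_cast (tsub_add_cancel_of_le hk).le), fun n hn => ?_⟩
  have hk' : k = (n + 1 : ℕ) := by
    rw [← tsub_add_cancel_of_le hk, hn]; push_cast; rfl
  subst hk'
  exact holderNear_iteratedFDeriv_fderiv.2 hf.holderNear

theorem of_fderiv (hf : ContDiffAt ℝ k f x) (hk : 1 ≤ k)
    (h : CkaAt (k - 1) α (_root_.fderiv ℝ f) x) : CkaAt k α f x := by
  refine ⟨hf, fun n hn => ?_⟩
  subst hn
  obtain ⟨m, rfl⟩ : ∃ m, n = m + 1 := Nat.exists_eq_succ_of_ne_zero fun h0 => by simp [h0] at hk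
  refine holderNear_iteratedFDeriv_fderiv.1 (holderNear (n := m) ?_)
  have : ((m + 1 : ℕ) : ℕ∞) - 1 = m := by
    simpa using (ENat.natCast_sub (m + 1) 1).symm
  rwa [this] at h

end CkaAt

/-- The inverse of a local homeomorphism of class `C^{k,α}_loc` with invertible derivative. -/
theorem OpenPartialHomeomorph.ckaAt_symm [CompleteSpace V] {k : ℕ∞} (hk : 1 ≤ k) {α : ℝ≥0}
    (hα : α ≤ 1) (e : OpenPartialHomeomorph V W) {a : V} (ha : a ∈ e.source)
    (he : CkaAt k α e a) (hinv : (fderiv ℝ e a).IsInvertible) : CkaAt k α e.symm (e a) := by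
  have hsa : e.symm (e a) = a := e.left_inv ha
  obtain ⟨e', he'⟩ := hinv
  have hd : HasFDerivAt e (e' : V →L[ℝ] W) (e.symm (e a)) := by
    rw [hsa, he']; exact (he.differentiableAt hk).hasFDerivAt
  have hsymm : ContDiffAt ℝ k e.symm (e a) :=
    e.contDiffAt_symm (e.map_source ha) hd (by rw [hsa]; exact he.1)
  -- The inverse function theorem yields C^k. Hölder continuity of the top derivative comes from the
  -- formula D(e⁻¹) = (De ∘ e⁻¹)⁻¹, whose right side is of class C^{k-1,α}.
  refine CkaAt.of_fderiv hsymm hk ?_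
  have hs1 : ContDiffAt ℝ 1 e.symm (e a) := hsymm.of_le (by exact_mod_cast hk)
  have hs : CkaAt (k - 1) α e.symm (e a) :=
    CkaAt.of_contDiffAt hα (by rwa [tsub_add_cancel_of_le hk])
  have hde : CkaAt (k - 1) α (fderiv ℝ e ∘ e.symm) (e a) :=
    CkaAt.comp hα (by rw [hsa]; exact he.fderiv hk) hs (Or.inr hs1)
  have hinv : (fderiv ℝ e (e.symm (e a))).IsInvertible := ⟨e', by rw [hsa, he']⟩
  refine (hde.inverse hα hinv).congr ?_
  have hopen : ∀ᶠ y in 𝓝 (e a), (fderiv ℝ e (e.symm y)).IsInvertible := by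
    have hc := hde.continuousAt
    have : range ((↑) : (V ≃L[ℝ] W) → V →L[ℝ] W) ∈ 𝓝 ((fderiv ℝ e ∘ e.symm) (e a)) := by
      rw [show (fderiv ℝ e ∘ e.symm) (e a) = (e' : V →L[ℝ] W) by simp [hsa, he']]
      exact e'.nhds
    exact hc this
  have hdiff : ∀ᶠ y in 𝓝 (e a), DifferentiableAt ℝ e (e.symm y) := by
    have h0 := (he.contDiffAt_one hk).eventually (by simp)
    rw [← hsa] at h0
    filter_upwards [hs1.continuousAt.eventually h0] with y hy
    exact hy.differentiableAt one_ne_zero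
  filter_upwards [hopen, hdiff, e.open_target.mem_nhds (e.map_source ha)] with y hy hy' hyt
  obtain ⟨L, hL⟩ := hy
  have h1 : HasFDerivAt e (L : V →L[ℝ] W) (e.symm y) := by rw [hL]; exact hy'.hasFDerivAt
  rw [(e.hasFDerivAt_symm hyt h1).fderiv]
  simp [← hL]

end Normed

/-! ### Kernels of split operators and of pseudoinvertible morphisms of para-Hilbert spaces -/

section KerProj

variable {F G : Type*} [AddCommGroup F] [Module ℝ F] [TopologicalSpace F] [IsTopologicalAddGroup F]
  [AddCommGroup G] [Module ℝ G] [TopologicalSpace G]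

/-- The projection `1 - b a` onto the kernel of `a`, for an operator `b` with `a b a = a`. -/
def kerProj (a : F →L[ℝ] G) (b : G →L[ℝ] F) (h : ∀ v, a (b (a v)) = a v) :
    F →L[ℝ] LinearMap.ker a.toLinearMap :=
  (ContinuousLinearMap.id ℝ F - b.comp a).codRestrict _ fun v => by simp [h]

theorem coe_kerProj (a : F →L[ℝ] G) (b : G →L[ℝ] F) (h : ∀ v, a (b (a v)) = a v) (v : F) :
    (kerProj a b h v : F) = v - b (a v) := rfl

theorem coe_kerProj_of_mem {a : F →L[ℝ] G} {b : G →L[ℝ] F} (h : ∀ v, a (b (a v)) = a v) {v : F}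
    (hv : a v = 0) : (kerProj a b h v : F) = v := by
  simp [coe_kerProj, hv]

theorem kerProj_coe {a : F →L[ℝ] G} {b : G →L[ℝ] F} (h : ∀ v, a (b (a v)) = a v)
    (v : LinearMap.ker a.toLinearMap) : kerProj a b h v = v :=
  Subtype.ext (coe_kerProj_of_mem h v.2)

end KerProj

section RestrictDual

variable {F G K L : Type*} [AddCommGroup F] [Module ℝ F] [TopologicalSpace F]
  [AddCommGroup G] [Module ℝ G] [TopologicalSpace G] [AddCommGroup K] [Module ℝ K]
  [TopologicalSpace K] [AddCommGroup L] [Module ℝ L] [TopologicalSpace L]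

/-- The projectors r p and s q are transposes of each other under I. Extend a functional from L to G
by q, apply I⁻¹ and project by p: this inverts the restriction of I. -/
theorem ContinuousLinearMap.IsInvertible.restrict_dual {I : F →L[ℝ] G →L[ℝ] ℝ} (hI : I.IsInvertible)
    {p : F →L[ℝ] K} {r : K →L[ℝ] F} {q : G →L[ℝ] L} {s : L →L[ℝ] G} (hp : ∀ x, p (r x) = x)
    (hq : ∀ x, q (s x) = x) (h : ∀ v w, I (r (p v)) w = I v (s (q w))) :
    ((ContinuousLinearMap.precomp ℝ s).comp (I.comp r)).IsInvertible := by
  obtain ⟨e, rfl⟩ := hI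
  refine ⟨ContinuousLinearEquiv.equivOfInverse
    ((ContinuousLinearMap.precomp ℝ s).comp ((e : F →L[ℝ] G →L[ℝ] ℝ).comp r))
    (p.comp ((e.symm : (G →L[ℝ] ℝ) →L[ℝ] F).comp (ContinuousLinearMap.precomp ℝ q))) ?_ ?_, rfl⟩
  · intro x
    -- The vector r x is fixed by r p, so its functional is fixed by the transpose s q.
    have : (e (r x)).comp (s.comp q) = e (r x) := by
      ext w
      have := h (r x) w
      simpa [hp] using this.symm
    simp only [ContinuousLinearMap.comp_apply, ContinuousLinearMap.precomp_apply,
      ContinuousLinearEquiv.coe_coe, ContinuousLinearMap.comp_assoc]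
    rw [this]
    simp [hp]
  · intro φ
    ext w
    have := h (e.symm (φ.comp q)) (s w)
    simp only [ContinuousLinearEquiv.coe_coe, ContinuousLinearEquiv.apply_symm_apply, hq,
      ContinuousLinearMap.comp_apply] at this
    simpa using this

end RestrictDual

section Kernel

variable {X₁ H₁ Y₁ X₂ H₂ Y₂ : Type*}
  [AddCommGroup X₁] [Module ℝ X₁] [TopologicalSpace X₁]
  [AddCommGroup H₁] [Module ℝ H₁] [TopologicalSpace H₁]
  [AddCommGroup Y₁] [Module ℝ Y₁] [TopologicalSpace Y₁]
  [AddCommGroup X₂] [Module ℝ X₂] [TopologicalSpace X₂]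
  [AddCommGroup H₂] [Module ℝ H₂] [TopologicalSpace H₂]
  [AddCommGroup Y₂] [Module ℝ Y₂] [TopologicalSpace Y₂]
  {E₁ : ParaHilbertSpace X₁ H₁ Y₁} {E₂ : ParaHilbertSpace X₂ H₂ Y₂}

namespace ParaHilbertMor

variable (A : ParaHilbertMor E₁ E₂)

/-- The restriction of `i` to the kernels of a morphism. -/
def kerI : LinearMap.ker A.X.toLinearMap →L[ℝ] LinearMap.ker A.H.toLinearMap :=
  (E₁.i.comp (Submodule.subtypeL _)).codRestrict _ fun u => by
    have : A.X u = 0 := u.2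
    simp [A.comm_i, this]

/-- The restriction of `j` to the kernels of a morphism. -/
def kerJ : LinearMap.ker A.H.toLinearMap →L[ℝ] LinearMap.ker A.Y.toLinearMap :=
  (E₁.j.comp (Submodule.subtypeL _)).codRestrict _ fun u => by
    have : A.H u = 0 := u.2
    simp [A.comm_j, this]

/-- For a pseudoinverse `B` of `A`, the transpose of the projector `1 - B A` on the scale `X` with
respect to `J` is the projector `1 - B A` on the scale `Y`. -/
theorem IsPseudoinverse.J_apply {A : ParaHilbertMor E₁ E₂} {B : ParaHilbertMor E₂ E₁}
    (h : A.IsPseudoinverse B) (u : X₁) (w : Y₁) :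
    E₁.J (B.X (A.X u)) w = E₁.J u (B.Y (A.Y w)) := by
  -- The range of j is dense in Y, and on it J is expressed through the inner product of H, where B
  -- A is self-adjoint.
  refine E₁.j_dense.induction_on w (isClosed_eq (by fun_prop) (by fun_prop)) fun v => ?_
  rw [← E₁.comm, ← B.comm_i, ← A.comm_i, h.2.2, A.comm_j, B.comm_j, E₁.comm]

variable [IsTopologicalAddGroup X₁] [IsTopologicalAddGroup H₁] [IsTopologicalAddGroup Y₁]

/-- The kernel of a morphism that has a pseudoinverse is a para-Hilbert space. -/
noncomputable def ker (hB : ∃ B, A.IsPseudoinverse B) : ParaHilbertSpace (LinearMap.ker A.X.toLinearMap)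
    (LinearMap.ker A.H.toLinearMap) (LinearMap.ker A.Y.toLinearMap) where
  i := A.kerI
  j := A.kerJ
  I := (ContinuousLinearMap.precomp ℝ (Submodule.subtypeL _)).comp
    (E₁.I.comp (Submodule.subtypeL _))
  J := (ContinuousLinearMap.precomp ℝ (Submodule.subtypeL _)).comp
    (E₁.J.comp (Submodule.subtypeL _))
  i_injective := fun u v h => Subtype.ext (E₁.i_injective (congrArg Subtype.val h))
  i_dense := by
    obtain ⟨B, ⟨hX, -, hH, -⟩, -⟩ := hB
    -- A continuous surjection preserves density, and the projectors commute with i, so the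
    -- projection of i u is the image under i of the projection of u.
    have hp : Function.Surjective (kerProj A.H B.H hH) := fun v => ⟨v, kerProj_coe hH v⟩
    have hd := hp.denseRange.comp E₁.i_dense (kerProj A.H B.H hH).continuous
    refine hd.mono ?_
    rintro _ ⟨u, rfl⟩
    refine ⟨kerProj A.X B.X hX u, Subtype.ext ?_⟩
    change E₁.i (u - B.X (A.X u)) = E₁.i u - B.H (A.H (E₁.i u))
    rw [map_sub, A.comm_i, B.comm_i]
  j_injective := fun u v h => Subtype.ext (E₁.j_injective (congrArg Subtype.val h))
  j_dense := by
    obtain ⟨B, ⟨-, -, hH, -, hY, -⟩, -⟩ := hB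
    have hp : Function.Surjective (kerProj A.Y B.Y hY) := fun v => ⟨v, kerProj_coe hY v⟩
    have hd := hp.denseRange.comp E₁.j_dense (kerProj A.Y B.Y hY).continuous
    refine hd.mono ?_
    rintro _ ⟨u, rfl⟩
    refine ⟨kerProj A.H B.H hH u, Subtype.ext ?_⟩
    change E₁.j (u - B.H (A.H u)) = E₁.j u - B.Y (A.Y (E₁.j u))
    rw [map_sub, A.comm_j, B.comm_j]
  I_symm := fun v w => E₁.I_symm v w
  I_pos := fun v hv => E₁.I_pos v fun h => hv (Subtype.ext h)
  I_iso := by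
    obtain ⟨B, ⟨-, -, hH, -⟩, -, hI⟩ := hB
    refine E₁.I_iso.restrict_dual (kerProj_coe hH) (kerProj_coe hH) fun v w => ?_
    change E₁.I (v - B.H (A.H v)) w = E₁.I v (w - B.H (A.H w))
    rw [map_sub, map_sub, sub_apply, hI]
  J_iso := by
    obtain ⟨B, hB⟩ := hB
    obtain ⟨hX, -, -, -, hY, -⟩ := hB.1
    refine E₁.J_iso.restrict_dual (kerProj_coe hX) (kerProj_coe hY) fun v w => ?_
    change E₁.J (v - B.X (A.X v)) w = E₁.J v (w - B.Y (A.Y w))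
    rw [map_sub, map_sub, sub_apply, hB.J_apply]
  comm := fun u v => E₁.comm u v

end ParaHilbertMor

end Kernel

/-! ### Banach manifolds: changes of charts, tangent spaces and regular functions -/

section ThroughChart

theorem OpenPartialHomeomorph.comp_eventuallyEq {M V B W : Type*} [TopologicalSpace M]
    [TopologicalSpace V] [TopologicalSpace B] {g : V → M} {h : M → W} {p : V} (b : OpenPartialHomeomorph M B)
    (hg : ContinuousAt g p) (hp : g p ∈ b.source) :
    (h ∘ b.symm) ∘ (b ∘ g) =ᶠ[𝓝 p] h ∘ g := by
  filter_upwards [hg (b.open_source.mem_nhds hp)] with z hz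
  simp only [Function.comp_apply]
  rw [b.left_inv hz]

variable {M : Type*} [TopologicalSpace M] {V B W : Type*} [NormedAddCommGroup V] [NormedSpace ℝ V]
  [NormedAddCommGroup B] [NormedSpace ℝ B] [NormedAddCommGroup W] [NormedSpace ℝ W]
  {l : ℕ∞} {α : ℝ≥0} {g : V → M} {h : M → W} {p : V}

/-- The factor b ∘ g is C^1, so that h may be merely Hölder continuous when l = 0. -/
theorem CkaAt.through_chart (hα : α ≤ 1) (b : OpenPartialHomeomorph M B) (hg : ContinuousAt g p)
    (hp : g p ∈ b.source) (h1 : CkaAt l α (h ∘ b.symm) (b (g p))) (h2 : CkaAt l α (b ∘ g) p)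
    (h3 : ContDiffAt ℝ 1 (b ∘ g) p) : CkaAt l α (h ∘ g) p :=
  (CkaAt.comp hα (g := h ∘ b.symm) (f := b ∘ g) h1 h2 (Or.inr h3)).congr
    (b.comp_eventuallyEq hg hp)

theorem fderiv_through_chart (b : OpenPartialHomeomorph M B) (hg : ContinuousAt g p)
    (hp : g p ∈ b.source) (h1 : DifferentiableAt ℝ (h ∘ b.symm) (b (g p)))
    (h2 : DifferentiableAt ℝ (b ∘ g) p) :
    fderiv ℝ (h ∘ g) p = (fderiv ℝ (h ∘ b.symm) (b (g p))).comp (fderiv ℝ (b ∘ g) p) := by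
  rw [← (b.comp_eventuallyEq (h := h) hg hp).fderiv_eq, fderiv_comp p h1 h2]
  rfl

end ThroughChart

namespace BanachManifold

variable {M : Type u} [TopologicalSpace M] {N : Type v} [TopologicalSpace N] {k l : ℕ∞} {α : ℝ≥0}

theorem fderiv_chart_self (𝔐 : BanachManifold M k α) {c : 𝔐.ι} {x : M}
    (hc : x ∈ (𝔐.chart c).source) :
    fderiv ℝ (𝔐.chart c ∘ (𝔐.chart c).symm) (𝔐.chart c x) = ContinuousLinearMap.id ℝ _ := by
  have : 𝔐.chart c ∘ (𝔐.chart c).symm =ᶠ[𝓝 (𝔐.chart c x)] id := by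
    filter_upwards [(𝔐.chart c).open_target.mem_nhds ((𝔐.chart c).map_source hc)] with z hz
    exact (𝔐.chart c).right_inv hz
  rw [this.fderiv_eq, fderiv_id]

theorem fderiv_comp_chart (𝔐 : BanachManifold M k α) (hk : 1 ≤ k) {c d : 𝔐.ι} {x : M}
    (hc : x ∈ (𝔐.chart c).source) (hd : x ∈ (𝔐.chart d).source) {W : Type*}
    [NormedAddCommGroup W] [NormedSpace ℝ W] {h : M → W}
    (hh : DifferentiableAt ℝ (h ∘ (𝔐.chart d).symm) (𝔐.chart d x)) :
    fderiv ℝ (h ∘ (𝔐.chart c).symm) (𝔐.chart c x) =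
      (fderiv ℝ (h ∘ (𝔐.chart d).symm) (𝔐.chart d x)).comp
        (fderiv ℝ (𝔐.chart d ∘ (𝔐.chart c).symm) (𝔐.chart c x)) := by
  have hx : (𝔐.chart c).symm (𝔐.chart c x) = x := (𝔐.chart c).left_inv hc
  have := fderiv_through_chart (h := h) (p := 𝔐.chart c x) (g := (𝔐.chart c).symm) (𝔐.chart d)
    ((𝔐.chart c).continuousAt_symm ((𝔐.chart c).map_source hc)) (by rwa [hx]) (by rwa [hx])
    ((𝔐.compat c d x hc hd).differentiableAt hk)
  rwa [hx] at this

theorem fderiv_dchart (𝔐 : BanachManifold M k α) {c d : 𝔐.ι} {x : M}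
    (hc : x ∈ (𝔐.chart c).source) (hd : x ∈ (𝔐.chart d).source) (v : 𝔐.TangentSpace x) :
    fderiv ℝ (𝔐.chart d ∘ (𝔐.chart c).symm) (𝔐.chart c x) (𝔐.dchart c x v) = 𝔐.dchart d x v :=
  v.2.2 c d hc hd

theorem fderiv_comp_dchart (𝔐 : BanachManifold M k α) (hk : 1 ≤ k) {c d : 𝔐.ι} {x : M}
    (hc : x ∈ (𝔐.chart c).source) (hd : x ∈ (𝔐.chart d).source) {W : Type*}
    [NormedAddCommGroup W] [NormedSpace ℝ W] {h : M → W}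
    (hh : DifferentiableAt ℝ (h ∘ (𝔐.chart d).symm) (𝔐.chart d x)) (v : 𝔐.TangentSpace x) :
    fderiv ℝ (h ∘ (𝔐.chart c).symm) (𝔐.chart c x) (𝔐.dchart c x v) =
      fderiv ℝ (h ∘ (𝔐.chart d).symm) (𝔐.chart d x) (𝔐.dchart d x v) := by
  rw [𝔐.fderiv_comp_chart hk hc hd hh, ContinuousLinearMap.comp_apply, 𝔐.fderiv_dchart hc hd]

open Classical in
/-- The tangent vector at `x` that is represented by a given vector in the chart `c`. -/
noncomputable def ofChart (𝔐 : BanachManifold M k α) (hk : 1 ≤ k) {c : 𝔐.ι} {x : M}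
    (hc : x ∈ (𝔐.chart c).source) : 𝔐.V c →L[ℝ] 𝔐.TangentSpace x :=
  (ContinuousLinearMap.pi fun d =>
    if x ∈ (𝔐.chart d).source then fderiv ℝ (𝔐.chart d ∘ (𝔐.chart c).symm) (𝔐.chart c x)
    else 0).codRestrict _ fun v => by
      refine ⟨fun d hd => by simp [hd], fun d d' hd hd' => ?_⟩
      simp only [ContinuousLinearMap.coe_pi', if_pos hd, if_pos hd']
      rw [𝔐.fderiv_comp_chart hk hc hd (h := 𝔐.chart d')
        ((𝔐.compat d d' x hd hd').differentiableAt hk)]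
      rfl

theorem dchart_ofChart (𝔐 : BanachManifold M k α) (hk : 1 ≤ k) {c d : 𝔐.ι} {x : M}
    (hc : x ∈ (𝔐.chart c).source) (hd : x ∈ (𝔐.chart d).source) (v : 𝔐.V c) :
    𝔐.dchart d x (𝔐.ofChart hk hc v) =
      fderiv ℝ (𝔐.chart d ∘ (𝔐.chart c).symm) (𝔐.chart c x) v := by
  classical
  change (if x ∈ (𝔐.chart d).source then
    fderiv ℝ (𝔐.chart d ∘ (𝔐.chart c).symm) (𝔐.chart c x) else 0) v = _
  rw [if_pos hd]

/-- The transformation law determines the entries in all charts around x, and the other entries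
vanish by definition. -/
theorem dchart_injective (𝔐 : BanachManifold M k α) {c : 𝔐.ι} {x : M}
    (hc : x ∈ (𝔐.chart c).source) : Function.Injective (𝔐.dchart c x) := by
  intro v w h
  refine Subtype.ext (funext fun d => ?_)
  by_cases hd : x ∈ (𝔐.chart d).source
  · have hv := 𝔐.fderiv_dchart hc hd v
    rw [h, 𝔐.fderiv_dchart hc hd w] at hv
    exact hv.symm
  · rw [v.2.1 d hd, w.2.1 d hd]

/-- The differential of a chart as an isomorphism. -/
noncomputable def tangentEquiv (𝔐 : BanachManifold M k α) (hk : 1 ≤ k) {c : 𝔐.ι} {x : M}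
    (hc : x ∈ (𝔐.chart c).source) : 𝔐.TangentSpace x ≃L[ℝ] 𝔐.V c :=
  have hr (v) : 𝔐.dchart c x (𝔐.ofChart hk hc v) = v := by
    rw [𝔐.dchart_ofChart hk hc hc, 𝔐.fderiv_chart_self hc]; rfl
  ContinuousLinearEquiv.equivOfInverse (𝔐.dchart c x) (𝔐.ofChart hk hc)
    (fun v => 𝔐.dchart_injective hc (hr _)) hr

theorem dchart_tangentEquiv_symm (𝔐 : BanachManifold M k α) (hk : 1 ≤ k) {c : 𝔐.ι} {x : M}
    (hc : x ∈ (𝔐.chart c).source) (w : 𝔐.V c) :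
    𝔐.dchart c x ((𝔐.tangentEquiv hk hc).symm w) = w :=
  (𝔐.tangentEquiv hk hc).apply_symm_apply w

namespace RegAt

variable {𝔐 : BanachManifold M k α} {x : M} {W Z V : Type*} [NormedAddCommGroup W] [NormedSpace ℝ W]
  [NormedAddCommGroup Z] [NormedSpace ℝ Z] [NormedAddCommGroup V] [NormedSpace ℝ V]

theorem congr {f g : M → W} (hf : 𝔐.RegAt l f x) (h : f =ᶠ[𝓝 x] g) : 𝔐.RegAt l g x := by
  intro c hc
  refine (hf c hc).congr ?_
  have ht := (𝔐.chart c).tendsto_symm hc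
  exact ht.eventually h

theorem continuousAt {f : M → W} (hf : 𝔐.RegAt l f x) : ContinuousAt f x := by
  obtain ⟨c, hc⟩ := 𝔐.cover x
  have h := ContinuousAt.comp (f := 𝔐.chart c) (g := f ∘ (𝔐.chart c).symm) (hf c hc).continuousAt
    ((𝔐.chart c).continuousAt hc)
  refine h.congr ?_
  filter_upwards [(𝔐.chart c).open_source.mem_nhds hc] with y hy
  simp [(𝔐.chart c).left_inv hy]

theorem const (hα : α ≤ 1) (w : W) : 𝔐.RegAt l (fun _ => w) x := fun _ _ => CkaAt.const hα w

theorem clm_comp (hα : α ≤ 1) {S : M → W →L[ℝ] Z} {T : M → V →L[ℝ] W} (hS : 𝔐.RegAt l S x)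
    (hT : 𝔐.RegAt l T x) : 𝔐.RegAt l (fun y => (S y).comp (T y)) x :=
  fun c hc => (hS c hc).clm_comp hα (hT c hc)

theorem clm_apply (hα : α ≤ 1) (L : W →L[ℝ] Z) {f : M → W} (hf : 𝔐.RegAt l f x) :
    𝔐.RegAt l (fun y => L (f y)) x :=
  fun c hc => (hf c hc).clm_apply hα L

theorem add (hα : α ≤ 1) {f g : M → W} (hf : 𝔐.RegAt l f x) (hg : 𝔐.RegAt l g x) :
    𝔐.RegAt l (fun y => f y + g y) x :=
  fun c hc => (hf c hc).add hα (hg c hc)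

theorem sub (hα : α ≤ 1) {f g : M → W} (hf : 𝔐.RegAt l f x) (hg : 𝔐.RegAt l g x) :
    𝔐.RegAt l (fun y => f y - g y) x :=
  fun c hc => (hf c hc).sub hα (hg c hc)

theorem inverse [CompleteSpace W] (hα : α ≤ 1) {T : M → W →L[ℝ] Z} (hT : 𝔐.RegAt l T x)
    (h : (T x).IsInvertible) : 𝔐.RegAt l (fun y => (T y).inverse) x :=
  fun c hc => (hT c hc).inverse hα (by simpa [(𝔐.chart c).left_inv hc] using h)

theorem precomp (hα : α ≤ 1) {T : M → V →L[ℝ] W} (hT : 𝔐.RegAt l T x) :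
    𝔐.RegAt l (fun y => (ContinuousLinearMap.precomp ℝ (T y) : (W →L[ℝ] ℝ) →L[ℝ] V →L[ℝ] ℝ)) x :=
  (hT.clm_apply hα (ContinuousLinearMap.compL ℝ V W ℝ).flip).congr
    (Eventually.of_forall fun _ => ContinuousLinearMap.ext fun _ => rfl)

/-- Regular functions can be pulled back by regular maps. -/
theorem comp_map (hα : α ≤ 1) (hk : 1 ≤ k) (hl : l ≤ k) {𝔑 : BanachManifold N k α} {φ : M → N}
    (hφ : 𝔐.IsRegularMap 𝔑 φ) {f : N → W} (hf : 𝔑.RegAt l f (φ x)) :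
    𝔐.RegAt l (fun y => f (φ y)) x := by
  intro c hc
  obtain ⟨d, hd⟩ := 𝔑.cover (φ x)
  have hx : (𝔐.chart c).symm (𝔐.chart c x) = x := (𝔐.chart c).left_inv hc
  have hreg := hφ.2 c d x hc hd
  refine CkaAt.through_chart (h := f) (g := φ ∘ (𝔐.chart c).symm) hα (𝔑.chart d)
    (hφ.1.continuousAt.comp ((𝔐.chart c).continuousAt_symm ((𝔐.chart c).map_source hc)))
    ?_ ?_ (hreg.mono hα hl) (hreg.contDiffAt_one hk)
  · simpa [hx] using hd
  · simpa [hx] using hf d hd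

/-- Regularity can be checked in one chart. -/
theorem of_chart (hα : α ≤ 1) (hk : 1 ≤ k) (hl : l ≤ k) {d : 𝔐.ι} (hd : x ∈ (𝔐.chart d).source)
    {f : M → W} (hf : CkaAt l α (f ∘ (𝔐.chart d).symm) (𝔐.chart d x)) : 𝔐.RegAt l f x := by
  intro c hc
  have hx : (𝔐.chart c).symm (𝔐.chart c x) = x := (𝔐.chart c).left_inv hc
  have hreg := 𝔐.compat c d x hc hd
  exact CkaAt.through_chart (h := f) (g := (𝔐.chart c).symm) hα (𝔐.chart d)
    ((𝔐.chart c).continuousAt_symm ((𝔐.chart c).map_source hc))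
    (by rwa [hx]) (by rwa [hx]) (hreg.mono hα hl) (hreg.contDiffAt_one hk)

end RegAt

end BanachManifold

namespace BanachBundle

variable {M : Type u} [TopologicalSpace M] {k l : ℕ∞} {α : ℝ≥0} {𝔐 : BanachManifold M k α}
  {F : M → Type u} [∀ x, AddCommGroup (F x)] [∀ x, Module ℝ (F x)] [∀ x, TopologicalSpace (F x)]

/-- The fibres carry only a topology; compatibility with addition is transported from the model
space. The continuity of 1 - B A rests on it. -/
theorem isTopologicalAddGroup (B : BanachBundle 𝔐 l F) (x : M) : IsTopologicalAddGroup (F x) := by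
  obtain ⟨i, hi⟩ := B.cover x
  let e : F x ≃L[ℝ] B.V i := ContinuousLinearEquiv.equivOfInverse (B.triv i x) (B.trivInv i x)
    (B.left_inv i x hi) (B.right_inv i x hi)
  exact e.toHomeomorph.isInducing.topologicalAddGroup e

end BanachBundle

/-! ### Level sets of split submersions -/

/-- A chart of `M` that straightens the level set of `Φ` over `y₀`: up to a translation, the map `Φ`
is represented by the split surjective operator `T`. -/
structure LevelChart {M : Type u} [TopologicalSpace M] {N : Type v} [TopologicalSpace N] {k : ℕ∞}
    {α : ℝ≥0} (𝔐 : BanachManifold M k α) (𝔑 : BanachManifold N k α) (Φ : M → N) (y₀ : N) where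
  e : 𝔐.ι
  d : 𝔑.ι
  ψ : OpenPartialHomeomorph M (𝔐.V e)
  T : 𝔐.V e →L[ℝ] 𝔑.V d
  R : 𝔑.V d →L[ℝ] 𝔐.V e
  right_inv : ∀ w, T (R w) = w
  mem_source : y₀ ∈ (𝔑.chart d).source
  source_subset : ψ.source ⊆ (𝔐.chart e).source
  maps_source : ∀ x ∈ ψ.source, Φ x ∈ (𝔑.chart d).source
  level : ∀ x ∈ ψ.source, T (ψ x) = 𝔑.chart d (Φ x) - 𝔑.chart d y₀
  reg : ∀ x ∈ ψ.source, CkaAt k α (ψ ∘ (𝔐.chart e).symm) (𝔐.chart e x)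
  reg_symm : ∀ x ∈ ψ.source, CkaAt k α (𝔐.chart e ∘ ψ.symm) (ψ x)

/-- Implicit function theorem: around a point where the differential of `Φ` has a right inverse,
the level set of `Φ` can be straightened. -/
theorem BanachManifold.IsRegularMap.exists_levelChart {M : Type u} [TopologicalSpace M]
    {N : Type v} [TopologicalSpace N] {k : ℕ∞} (hk : 1 ≤ k) {α : ℝ≥0} (hα : α ≤ 1)
    {𝔐 : BanachManifold M k α} {𝔑 : BanachManifold N k α} {Φ : M → N} (hΦ : 𝔐.IsRegularMap 𝔑 Φ)
    {e : 𝔐.ι} {d : 𝔑.ι} {x : M} (he : x ∈ (𝔐.chart e).source) (hd : Φ x ∈ (𝔑.chart d).source)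
    (R : 𝔑.V d →L[ℝ] 𝔐.V e)
    (hR : ∀ w, fderiv ℝ (𝔑.chart d ∘ Φ ∘ (𝔐.chart e).symm) (𝔐.chart e x) (R w) = w) :
    ∃ c : LevelChart 𝔐 𝔑 Φ (Φ x), x ∈ c.ψ.source := by
  set f := 𝔑.chart d ∘ Φ ∘ (𝔐.chart e).symm with hf
  set p := 𝔐.chart e x
  set T := fderiv ℝ f p
  have hpx : (𝔐.chart e).symm p = x := (𝔐.chart e).left_inv he
  have hfp : f p = 𝔑.chart d (Φ x) := by simp [hf, hpx]
  -- The correction term makes T G(z) = f(z) - f(p) hold exactly, because T R = 1, and it has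
  -- vanishing derivative at p.
  let G : 𝔐.V e → 𝔐.V e := fun z => (z - p) + R (f z - f p - T (z - p))
  have hTG (z) : T (G z) = f z - f p := by simp [G, hR]
  have hG {z} (hz : CkaAt k α f z) : CkaAt k α G z := by
    have h1 : CkaAt k α (fun z => z - p) z :=
      CkaAt.of_contDiff hα fun _ => contDiff_id.sub contDiff_const
    exact h1.add hα (((hz.sub hα (CkaAt.const hα (f p))).sub hα (h1.clm_apply hα T)).clm_apply hα R)
  have hfreg : CkaAt k α f p := hΦ.2 e d x he hd
  have hGp : CkaAt k α G p := hG hfreg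
  have hGd : HasFDerivAt G ((ContinuousLinearEquiv.refl ℝ (𝔐.V e) : 𝔐.V e ≃L[ℝ] 𝔐.V e) :
      𝔐.V e →L[ℝ] 𝔐.V e) p := by
    have h1 : HasFDerivAt (fun z => z - p) (ContinuousLinearMap.id ℝ (𝔐.V e)) p :=
      (hasFDerivAt_id p).sub_const p
    have h2 : HasFDerivAt f T p := (hfreg.differentiableAt hk).hasFDerivAt
    have h3 := h1.add (R.hasFDerivAt.comp p ((h2.sub_const (f p)).sub (T.hasFDerivAt.comp p h1)))
    have h4 : ContinuousLinearMap.id ℝ (𝔐.V e) + R.comp (T - T.comp (ContinuousLinearMap.id ℝ _)) =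
        ((ContinuousLinearEquiv.refl ℝ (𝔐.V e) : 𝔐.V e ≃L[ℝ] 𝔐.V e) : 𝔐.V e →L[ℝ] 𝔐.V e) := by
      ext; simp
    rw [← h4]
    exact h3
  have hk0 : ((k : ℕ∞) : WithTop ℕ∞) ≠ 0 := by
    have : k ≠ 0 := (one_pos.trans_le hk).ne'
    exact_mod_cast this
  let g := hGp.1.toOpenPartialHomeomorph G hGd hk0
  have hpg : p ∈ g.source := hGp.1.mem_toOpenPartialHomeomorph_source hGd hk0
  -- The domain is shrunk so that DG is invertible everywhere on it: regularity of the inverse is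
  -- needed at every point, not only at p.
  let O : Set (𝔐.V e) := interior {z | z ∈ (𝔐.chart e).target ∧
    Φ ((𝔐.chart e).symm z) ∈ (𝔑.chart d).source ∧ (fderiv ℝ G z).IsInvertible}
  have hpO : p ∈ O := by
    rw [mem_interior_iff_mem_nhds]
    have hpt : p ∈ (𝔐.chart e).target := (𝔐.chart e).map_source he
    have h1 : ∀ᶠ z in 𝓝 p, z ∈ (𝔐.chart e).target := (𝔐.chart e).open_target.mem_nhds hpt
    have h2 : ∀ᶠ z in 𝓝 p, Φ ((𝔐.chart e).symm z) ∈ (𝔑.chart d).source := by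
      have hc : ContinuousAt (Φ ∘ (𝔐.chart e).symm) p :=
        hΦ.1.continuousAt.comp ((𝔐.chart e).continuousAt_symm hpt)
      exact hc ((𝔑.chart d).open_source.mem_nhds (by simpa [hpx] using hd))
    have h3 : ∀ᶠ z in 𝓝 p, (fderiv ℝ G z).IsInvertible := by
      have hc := (hGp.fderiv hk).continuousAt
      have hn : range ((↑) : (𝔐.V e ≃L[ℝ] 𝔐.V e) → 𝔐.V e →L[ℝ] 𝔐.V e) ∈ 𝓝 (fderiv ℝ G p) := by
        rw [hGd.fderiv]
        exact (ContinuousLinearEquiv.refl ℝ (𝔐.V e)).nhds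
      exact hc hn
    exact h1.and (h2.and h3)
  let g' := g.restrOpen O isOpen_interior
  have hg's : g'.source = g.source ∩ O := g.restrOpen_source O isOpen_interior
  have hsrc {y} (hy : y ∈ ((𝔐.chart e).trans g').source) : y ∈ (𝔐.chart e).source ∧
      𝔐.chart e y ∈ g.source ∧ Φ y ∈ (𝔑.chart d).source ∧
      (fderiv ℝ G (𝔐.chart e y)).IsInvertible := by
    rw [OpenPartialHomeomorph.trans_source, hg's] at hy
    have h := interior_subset hy.2.2
    rw [mem_ofPred_eq, (𝔐.chart e).left_inv hy.1] at h
    exact ⟨hy.1, hy.2.1, h.2.1, h.2.2⟩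
  have hGreg {y} (hy : y ∈ ((𝔐.chart e).trans g').source) : CkaAt k α G (𝔐.chart e y) :=
    hG (hΦ.2 e d y (hsrc hy).1 (hsrc hy).2.2.1)
  refine ⟨{
    e := e
    d := d
    ψ := (𝔐.chart e).trans g'
    T := T
    R := R
    right_inv := hR
    mem_source := hd
    source_subset := fun y hy => (hsrc hy).1
    maps_source := fun y hy => (hsrc hy).2.2.1
    level := fun y hy => ?_
    reg := fun y hy => ?_
    reg_symm := fun y hy => ?_ }, ?_⟩
  · change T (G (𝔐.chart e y)) = _
    rw [hTG, hfp]
    simp [hf, (𝔐.chart e).left_inv (hsrc hy).1]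
  · refine (hGreg hy).congr ?_
    filter_upwards [(𝔐.chart e).open_target.mem_nhds ((𝔐.chart e).map_source (hsrc hy).1)] with z hz
    change G z = G (𝔐.chart e ((𝔐.chart e).symm z))
    rw [(𝔐.chart e).right_inv hz]
  · have hs := g.ckaAt_symm hk hα (hsrc hy).2.1 (hGreg hy) (hsrc hy).2.2.2
    refine hs.congr ?_
    have hgy : g.symm (g (𝔐.chart e y)) = 𝔐.chart e y := g.left_inv (hsrc hy).2.1
    have ht : (𝔐.chart e).target ∈ 𝓝 (g.symm (g (𝔐.chart e y))) := by
      rw [hgy]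
      exact (𝔐.chart e).open_target.mem_nhds ((𝔐.chart e).map_source (hsrc hy).1)
    filter_upwards [hs.continuousAt ht] with z hz
    change g.symm z = 𝔐.chart e ((𝔐.chart e).symm (g.symm z))
    rw [(𝔐.chart e).right_inv hz]
  · rw [OpenPartialHomeomorph.trans_source, hg's]
    exact ⟨he, hpg, hpO⟩

/-! ### Charts and tangent spaces of the level set -/

namespace LevelChart

variable {M : Type u} [TopologicalSpace M] {N : Type v} [TopologicalSpace N] {k : ℕ∞}
  {α : ℝ≥0} {𝔐 : BanachManifold M k α} {𝔑 : BanachManifold N k α} {Φ : M → N} {y₀ : N}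
  (c : LevelChart 𝔐 𝔑 Φ y₀)

/-- The projection onto the model space of the level set. -/
def P : 𝔐.V c.e →L[ℝ] LinearMap.ker c.T.toLinearMap :=
  kerProj c.T c.R fun v => c.right_inv (c.T v)

theorem coe_P {v : 𝔐.V c.e} (hv : c.T v = 0) : (c.P v : 𝔐.V c.e) = v :=
  coe_kerProj_of_mem _ hv

theorem T_ψ {x : M} (hx : x ∈ c.ψ.source) (h : Φ x = y₀) : c.T (c.ψ x) = 0 := by
  rw [c.level x hx, h, sub_self]

/-- Both points lie in the domain of one chart of N and have the same coordinates there. -/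
theorem Φ_symm {w : 𝔐.V c.e} (hw : w ∈ c.ψ.target) (h : c.T w = 0) : Φ (c.ψ.symm w) = y₀ := by
  have hs := c.ψ.map_target hw
  have := c.level _ hs
  rw [c.ψ.right_inv hw, h] at this
  exact (𝔑.chart c.d).injOn (c.maps_source _ hs) c.mem_source (sub_eq_zero.1 this.symm)

open Classical in
/-- The chart of the level set that is induced by a straightening chart. -/
noncomputable def chart (x₀ : {x : M // Φ x = y₀}) :
    OpenPartialHomeomorph {x : M // Φ x = y₀} (LinearMap.ker c.T.toLinearMap) where
  -- On the source ψ(x) already lies in ker T and P does not change it; P and the default value x₀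
  -- only serve to make the two maps total.
  toFun x := c.P (c.ψ x)
  invFun w := if h : Φ (c.ψ.symm w) = y₀ then ⟨c.ψ.symm w, h⟩ else x₀
  source := Subtype.val ⁻¹' c.ψ.source
  target := Subtype.val ⁻¹' c.ψ.target
  map_source' x hx := by
    rw [mem_preimage, c.coe_P (c.T_ψ hx x.2)]
    exact c.ψ.map_source hx
  map_target' w hw := by
    rw [mem_preimage, dif_pos (c.Φ_symm hw w.2)]
    exact c.ψ.map_target hw
  left_inv' x hx := by
    have h : c.ψ.symm (c.P (c.ψ x)) = x := by
      rw [c.coe_P (c.T_ψ hx x.2), c.ψ.left_inv hx]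
    refine Subtype.ext ?_
    rw [dif_pos (by rw [h]; exact x.2)]
    exact h
  right_inv' w hw := by
    rw [dif_pos (c.Φ_symm hw w.2)]
    refine Subtype.ext ?_
    change ((c.P (c.ψ (c.ψ.symm w))) : 𝔐.V c.e) = w
    rw [c.ψ.right_inv hw, c.coe_P w.2]
  open_source := c.ψ.open_source.preimage continuous_subtype_val
  open_target := c.ψ.open_target.preimage continuous_subtype_val
  continuousOn_toFun := c.P.continuous.comp_continuousOn
    (c.ψ.continuousOn.comp continuous_subtype_val.continuousOn fun _ h => h)
  continuousOn_invFun := by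
    refine Topology.IsInducing.subtypeVal.continuousOn_iff.2 ?_
    refine (c.ψ.continuousOn_symm.comp continuous_subtype_val.continuousOn fun _ h => h).congr ?_
    intro w hw
    simp only [Function.comp_apply]
    rw [dif_pos (c.Φ_symm hw w.2)]

theorem coe_chart (x₀ x : {x : M // Φ x = y₀}) (hx : x.1 ∈ c.ψ.source) :
    (c.chart x₀ x : 𝔐.V c.e) = c.ψ x :=
  c.coe_P (c.T_ψ hx x.2)

/-- The inverse chart is the restriction of ψ⁻¹ to ker T, which reduces calculus on the level set to
calculus in ψ. -/
theorem comp_chart_symm_eventuallyEq (x₀ x : {x : M // Φ x = y₀}) (hx : x.1 ∈ c.ψ.source)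
    {W : Type*} (h : M → W) :
    (h ∘ c.ψ.symm) ∘ (Submodule.subtypeL (LinearMap.ker c.T.toLinearMap)) =ᶠ[𝓝 (c.chart x₀ x)]
      h ∘ Subtype.val ∘ (c.chart x₀).symm := by
  filter_upwards [(c.chart x₀).open_target.mem_nhds ((c.chart x₀).map_source hx)] with w hw
  have : ((c.chart x₀).symm w).1 = c.ψ.symm w := by
    classical
    change (dite _ _ _ : {x : M // Φ x = y₀}).1 = _
    rw [dif_pos (c.Φ_symm hw w.2)]
  simp [this]

theorem ckaAt_comp_chart_symm (hα : α ≤ 1) (x₀ x : {x : M // Φ x = y₀}) (hx : x.1 ∈ c.ψ.source)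
    {W : Type*} [NormedAddCommGroup W] [NormedSpace ℝ W] {h : M → W}
    (hh : CkaAt k α (h ∘ c.ψ.symm) (c.ψ x)) :
    CkaAt k α (h ∘ Subtype.val ∘ (c.chart x₀).symm) (c.chart x₀ x) := by
  refine CkaAt.congr ?_ (c.comp_chart_symm_eventuallyEq x₀ x hx h)
  refine CkaAt.comp hα ?_ (CkaAt.of_contDiff hα fun _ => ContinuousLinearMap.contDiff _)
    (Or.inr (ContinuousLinearMap.contDiff _).contDiffAt)
  rw [Submodule.subtypeL_apply, c.coe_chart x₀ x hx]
  exact hh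

theorem fderiv_comp_chart_symm (x₀ x : {x : M // Φ x = y₀}) (hx : x.1 ∈ c.ψ.source)
    {W : Type*} [NormedAddCommGroup W] [NormedSpace ℝ W] {h : M → W}
    (hh : DifferentiableAt ℝ (h ∘ c.ψ.symm) (c.ψ x)) (w : LinearMap.ker c.T.toLinearMap) :
    fderiv ℝ (h ∘ Subtype.val ∘ (c.chart x₀).symm) (c.chart x₀ x) w =
      fderiv ℝ (h ∘ c.ψ.symm) (c.ψ x) w := by
  rw [← (c.comp_chart_symm_eventuallyEq x₀ x hx h).fderiv_eq, fderiv_comp, ContinuousLinearMap.fderiv,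
    Submodule.subtypeL_apply, c.coe_chart x₀ x hx]
  · rfl
  · rw [Submodule.subtypeL_apply, c.coe_chart x₀ x hx]
    exact hh
  · exact ContinuousLinearMap.differentiableAt _

/-- Since ψ need not belong to the atlas, regularity is transferred to it through the chart `c.e`.
-/
theorem ckaAt_comp_ψ_symm (hk : 1 ≤ k) (hα : α ≤ 1) {x : M} (hx : x ∈ c.ψ.source) {d : 𝔐.ι}
    (hd : x ∈ (𝔐.chart d).source) {W : Type*} [NormedAddCommGroup W] [NormedSpace ℝ W] {h : M → W}
    (hh : CkaAt k α (h ∘ (𝔐.chart d).symm) (𝔐.chart d x)) :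
    CkaAt k α (h ∘ c.ψ.symm) (c.ψ x) := by
  have hψ : c.ψ.symm (c.ψ x) = x := c.ψ.left_inv hx
  have he := BanachManifold.RegAt.of_chart hα hk le_rfl hd hh c.e (c.source_subset hx)
  have hc := c.ψ.continuousAt_symm (c.ψ.map_source hx)
  exact CkaAt.through_chart (h := h) (g := c.ψ.symm) hα (𝔐.chart c.e) hc
    (by rw [hψ]; exact c.source_subset hx) (by rwa [hψ]) (c.reg_symm x hx)
    ((c.reg_symm x hx).contDiffAt_one hk)

/-- The differential of a straightening chart. -/
noncomputable def dψ (x : M) : 𝔐.TangentSpace x →L[ℝ] 𝔐.V c.e :=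
  (fderiv ℝ (c.ψ ∘ (𝔐.chart c.e).symm) (𝔐.chart c.e x)).comp (𝔐.dchart c.e x)

theorem fderiv_dψ (hk : 1 ≤ k) (hα : α ≤ 1) {x : M} (hx : x ∈ c.ψ.source) {d : 𝔐.ι}
    (hd : x ∈ (𝔐.chart d).source) {W : Type*} [NormedAddCommGroup W] [NormedSpace ℝ W] {h : M → W}
    (hh : CkaAt k α (h ∘ (𝔐.chart d).symm) (𝔐.chart d x)) (v : 𝔐.TangentSpace x) :
    fderiv ℝ (h ∘ c.ψ.symm) (c.ψ x) (c.dψ x v) =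
      fderiv ℝ (h ∘ (𝔐.chart d).symm) (𝔐.chart d x) (𝔐.dchart d x v) := by
  have hxe := c.source_subset hx
  have hs : (𝔐.chart c.e).symm (𝔐.chart c.e x) = x := (𝔐.chart c.e).left_inv hxe
  have h1 := fderiv_through_chart (h := h) (p := 𝔐.chart c.e x) (g := (𝔐.chart c.e).symm) c.ψ
    ((𝔐.chart c.e).continuousAt_symm ((𝔐.chart c.e).map_source hxe)) (by rwa [hs])
    (by rw [hs]; exact (c.ckaAt_comp_ψ_symm hk hα hx hd hh).differentiableAt hk)
    ((c.reg x hx).differentiableAt hk)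
  rw [hs] at h1
  rw [← 𝔐.fderiv_comp_dchart hk hxe hd (hh.differentiableAt hk), h1]
  rfl

/-- This is the derivative of the identity `level`, which holds near x. -/
theorem T_dψ (hk : 1 ≤ k) {x : M} (hx : x ∈ c.ψ.source) (v : 𝔐.TangentSpace x) :
    c.T (c.dψ x v) = fderiv ℝ (𝔑.chart c.d ∘ Φ ∘ (𝔐.chart c.e).symm) (𝔐.chart c.e x)
      (𝔐.dchart c.e x v) := by
  have hxe := c.source_subset hx
  have h1 : (fun z => c.T ((c.ψ ∘ (𝔐.chart c.e).symm) z)) =ᶠ[𝓝 (𝔐.chart c.e x)]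
      fun z => (𝔑.chart c.d ∘ Φ ∘ (𝔐.chart c.e).symm) z - 𝔑.chart c.d y₀ := by
    filter_upwards [(𝔐.chart c.e).tendsto_symm hxe (c.ψ.open_source.mem_nhds hx)] with z hz
    exact c.level _ hz
  have h2 := h1.fderiv_eq (𝕜 := ℝ)
  rw [fderiv_sub_const] at h2
  rw [show (𝔑.chart c.d ∘ Φ ∘ (𝔐.chart c.e).symm) =
    fun z => (𝔑.chart c.d ∘ Φ ∘ (𝔐.chart c.e).symm) z from rfl, ← h2]
  have h3 := (c.T.hasFDerivAt.comp (𝔐.chart c.e x)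
    ((c.reg x hx).differentiableAt hk).hasFDerivAt).fderiv
  change fderiv ℝ (fun z => c.T ((c.ψ ∘ (𝔐.chart c.e).symm) z)) _ = _ at h3
  rw [h3]
  rfl

/-- The differential of a straightening chart as an isomorphism. -/
noncomputable def dψEquiv (hk : 1 ≤ k) (hα : α ≤ 1) {x : M} (hx : x ∈ c.ψ.source) :
    𝔐.TangentSpace x ≃L[ℝ] 𝔐.V c.e :=
  ContinuousLinearEquiv.equivOfInverse (c.dψ x)
    ((𝔐.ofChart hk (c.source_subset hx)).comp (fderiv ℝ (𝔐.chart c.e ∘ c.ψ.symm) (c.ψ x)))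
    (fun v => by
      have hxe := c.source_subset hx
      rw [ContinuousLinearMap.comp_apply, c.fderiv_dψ hk hα hx hxe (𝔐.compat _ _ x hxe hxe),
        𝔐.fderiv_chart_self hxe]
      exact (𝔐.tangentEquiv hk hxe).symm_apply_apply v)
    (fun w => by
      have hxe := c.source_subset hx
      have hψ : c.ψ.symm (c.ψ x) = x := c.ψ.left_inv hx
      have h1 := fderiv_through_chart (h := c.ψ) (p := c.ψ x) (g := c.ψ.symm) (𝔐.chart c.e)
        (c.ψ.continuousAt_symm (c.ψ.map_source hx)) (by rwa [hψ])
        (by rw [hψ]; exact (c.reg x hx).differentiableAt hk)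
        ((c.reg_symm x hx).differentiableAt hk)
      have h2 : c.ψ ∘ c.ψ.symm =ᶠ[𝓝 (c.ψ x)] id := by
        filter_upwards [c.ψ.open_target.mem_nhds (c.ψ.map_source hx)] with z hz
        exact c.ψ.right_inv hz
      rw [h2.fderiv_eq, fderiv_id, hψ] at h1
      change fderiv ℝ (c.ψ ∘ (𝔐.chart c.e).symm) (𝔐.chart c.e x)
        (𝔐.dchart c.e x (𝔐.ofChart hk hxe (fderiv ℝ (𝔐.chart c.e ∘ c.ψ.symm) (c.ψ x) w))) = w
      rw [𝔐.dchart_ofChart hk hxe hxe, 𝔐.fderiv_chart_self hxe]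
      exact (DFunLike.congr_fun h1 w).symm)

theorem dψEquiv_apply (hk : 1 ≤ k) (hα : α ≤ 1) {x : M} (hx : x ∈ c.ψ.source)
    (v : 𝔐.TangentSpace x) : c.dψEquiv hk hα hx v = c.dψ x v := rfl

theorem regAt_fderiv (hk : 1 ≤ k) (hα : α ≤ 1) {x : M} (hx : x ∈ c.ψ.source) :
    𝔐.RegAt (k - 1)
      (fun y => fderiv ℝ (c.ψ ∘ (𝔐.chart c.e).symm) (𝔐.chart c.e y)) x := by
  have hxe := c.source_subset hx
  refine BanachManifold.RegAt.of_chart hα hk tsub_le_self hxe ?_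
  refine ((c.reg x hx).fderiv hk).congr ?_
  filter_upwards [(𝔐.chart c.e).open_target.mem_nhds ((𝔐.chart c.e).map_source hxe)] with z hz
  simp only [Function.comp_apply]
  rw [(𝔐.chart c.e).right_inv hz]

/-- The level set as a Banach manifold. -/
noncomputable def levelSet (hk : 1 ≤ k) (hα : α ≤ 1)
    (c : {x : M // Φ x = y₀} → LevelChart 𝔐 𝔑 Φ y₀) (hc : ∀ x, x.1 ∈ (c x).ψ.source) :
    BanachManifold {x : M // Φ x = y₀} k α where
  ι := {x : M // Φ x = y₀}
  V x := LinearMap.ker (c x).T.toLinearMap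
  chart x := (c x).chart x
  cover x := ⟨x, hc x⟩
  compat a b x ha hb := by
    refine (c a).ckaAt_comp_chart_symm hα a x ha (h := fun y => (c b).P ((c b).ψ y)) ?_
    exact ((c a).ckaAt_comp_ψ_symm hk hα ha ((c b).source_subset hb)
      ((c b).reg x hb)).clm_apply hα (c b).P

section LevelSet

variable (hk : 1 ≤ k) (hα : α ≤ 1) (c : {x : M // Φ x = y₀} → LevelChart 𝔐 𝔑 Φ y₀)
  (hc : ∀ x, x.1 ∈ (c x).ψ.source)

theorem isRegularMap_val : (levelSet hk hα c hc).IsRegularMap 𝔐 Subtype.val :=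
  ⟨continuous_subtype_val, fun a d x ha hd => (c a).ckaAt_comp_chart_symm hα a x ha
    ((c a).ckaAt_comp_ψ_symm hk hα ha hd (𝔐.compat d d x hd hd))⟩

/-- The differential of the chart `a` of the level set as an isomorphism. -/
noncomputable def tangentEquivKer {a x : {x : M // Φ x = y₀}} (ha : x.1 ∈ (c a).ψ.source) :
    (levelSet hk hα c hc).TangentSpace x ≃L[ℝ] LinearMap.ker (c a).T.toLinearMap :=
  BanachManifold.tangentEquiv (levelSet hk hα c hc) hk (c := a) ha

theorem dchart_tangentEquivKer_symm {a x : {x : M // Φ x = y₀}} (ha : x.1 ∈ (c a).ψ.source)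
    (w : LinearMap.ker (c a).T.toLinearMap) :
    (levelSet hk hα c hc).dchart a x ((tangentEquivKer hk hα c hc ha).symm w) = w :=
  BanachManifold.dchart_tangentEquiv_symm (levelSet hk hα c hc) hk (c := a) ha w

/-- If a tangent vector of the level set is represented in one chart by a tangent vector `v` of `M`,
then so it is in all charts. -/
theorem dchart_levelSet {a b x : {x : M // Φ x = y₀}} (ha : x.1 ∈ (c a).ψ.source)
    (hb : x.1 ∈ (c b).ψ.source) (v : 𝔐.TangentSpace x.1) (hv : (c a).T ((c a).dψ x v) = 0)
    {w : (levelSet hk hα c hc).TangentSpace x}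
    (hw : (levelSet hk hα c hc).dchart a x w = (c a).P ((c a).dψ x v)) :
    (levelSet hk hα c hc).dchart b x w = (c b).P ((c b).dψ x v) := by
  have h1 : (levelSet hk hα c hc).dchart b x w = fderiv ℝ
      ((fun y => (c b).P ((c b).ψ y)) ∘ Subtype.val ∘ ((c a).chart a).symm) ((c a).chart a x)
      ((c a).P ((c a).dψ x v)) := by
    rw [← (levelSet hk hα c hc).fderiv_dchart (c := a) (d := b) ha hb w, hw]
    rfl
  have hb' := (c b).reg x hb
  have hbe := (c b).source_subset hb
  rw [h1, (c a).fderiv_comp_chart_symm a x ha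
    (((c a).ckaAt_comp_ψ_symm hk hα ha hbe (h := fun y => (c b).P ((c b).ψ y))
      (hb'.clm_apply hα (c b).P)).differentiableAt hk), (c a).coe_P hv,
    (c a).fderiv_dψ hk hα ha hbe (h := fun y => (c b).P ((c b).ψ y)) (hb'.clm_apply hα (c b).P)]
  have h3 := ((c b).P.hasFDerivAt.comp (𝔐.chart (c b).e x)
    (hb'.differentiableAt hk).hasFDerivAt).fderiv
  change fderiv ℝ ((fun y => (c b).P ((c b).ψ y)) ∘ (𝔐.chart (c b).e).symm) _ = _ at h3
  rw [h3]
  rfl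

/-- In straightening charts the inclusion is that of ker T into the model space, where w and v have
the same representative. -/
theorem isTangentImage_val {x : {x : M // Φ x = y₀}} (v : 𝔐.TangentSpace x.1)
    {w : (levelSet hk hα c hc).TangentSpace x}
    (hv : ∀ a, x.1 ∈ (c a).ψ.source → (c a).T ((c a).dψ x v) = 0)
    (hw : ∀ a, x.1 ∈ (c a).ψ.source →
      (levelSet hk hα c hc).dchart a x w = (c a).P ((c a).dψ x v)) :
    (levelSet hk hα c hc).IsTangentImage 𝔐 Subtype.val x w v := by
  intro a d ha hd
  rw [hw a ha]
  have hreg := 𝔐.compat d d x hd hd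
  refine ((c a).fderiv_comp_chart_symm a x ha (h := 𝔐.chart d)
    (((c a).ckaAt_comp_ψ_symm hk hα ha hd hreg).differentiableAt hk) _).trans ?_
  rw [(c a).coe_P (hv a ha), (c a).fderiv_dψ hk hα ha hd hreg, 𝔐.fderiv_chart_self hd]
  rfl

end LevelSet

end LevelChart

/-! ### Subbundles over a manifold that is mapped into the base -/

/-- A local trivialization, over an open set of the manifold `𝔐₀` mapped to `𝔐` by `φ`, of a family
`S` of subspaces of the fibres of the bundle `B` over `𝔐`: in the trivialization `i` of `B`, the
subspaces are the images of the operators `R y`, with left inverses `Q y`. -/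
structure SubbundleTriv {M₀ M : Type u} [TopologicalSpace M₀] [TopologicalSpace M] {k l : ℕ∞}
    {α : ℝ≥0} (𝔐₀ : BanachManifold M₀ k α) {𝔐 : BanachManifold M k α} {F : M → Type u}
    [∀ x, AddCommGroup (F x)] [∀ x, Module ℝ (F x)] [∀ x, TopologicalSpace (F x)]
    (B : BanachBundle 𝔐 l F) (φ : M₀ → M) (S : ∀ y, Submodule ℝ (F (φ y))) where
  i : B.ι
  W : Type u
  [normed : NormedAddCommGroup W]
  [space : NormedSpace ℝ W]
  [complete : CompleteSpace W]
  baseSet : Set M₀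
  isOpen_baseSet : IsOpen baseSet
  maps_baseSet : ∀ y ∈ baseSet, φ y ∈ B.baseSet i
  Q : M₀ → B.V i →L[ℝ] W
  R : M₀ → W →L[ℝ] B.V i
  regQ : ∀ y ∈ baseSet, 𝔐₀.RegAt l Q y
  regR : ∀ y ∈ baseSet, 𝔐₀.RegAt l R y
  mem : ∀ y ∈ baseSet, ∀ w, B.trivInv i (φ y) (R y w) ∈ S y
  Q_R : ∀ y ∈ baseSet, ∀ w, Q y (R y w) = w
  R_Q : ∀ y ∈ baseSet, ∀ v ∈ S y, R y (Q y (B.triv i (φ y) v)) = B.triv i (φ y) v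

attribute [instance] SubbundleTriv.normed SubbundleTriv.space SubbundleTriv.complete

namespace SubbundleTriv

variable {M₀ M : Type u} [TopologicalSpace M₀] [TopologicalSpace M] {k l : ℕ∞}
  {α : ℝ≥0} {𝔐₀ : BanachManifold M₀ k α} {𝔐 : BanachManifold M k α} {F : M → Type u}
  [∀ x, AddCommGroup (F x)] [∀ x, Module ℝ (F x)] [∀ x, TopologicalSpace (F x)]
  {B : BanachBundle 𝔐 l F} {φ : M₀ → M} {S : ∀ y, Submodule ℝ (F (φ y))}

/-- The local trivialization of the subbundle. -/
def triv (t : SubbundleTriv 𝔐₀ B φ S) (y : M₀) : S y →L[ℝ] t.W :=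
  ((t.Q y).comp (B.triv t.i (φ y))).comp (S y).subtypeL

open Classical in
/-- The inverse of the local trivialization of the subbundle. -/
noncomputable def trivInv (t : SubbundleTriv 𝔐₀ B φ S) (y : M₀) : t.W →L[ℝ] S y :=
  if h : y ∈ t.baseSet then
    ((B.trivInv t.i (φ y)).comp (t.R y)).codRestrict _ (t.mem y h)
  else 0

theorem coe_trivInv (t : SubbundleTriv 𝔐₀ B φ S) {y : M₀} (hy : y ∈ t.baseSet) (w : t.W) :
    (t.trivInv y w : F (φ y)) = B.trivInv t.i (φ y) (t.R y w) := by
  rw [trivInv, dif_pos hy]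
  rfl

theorem eventually_mem (t : SubbundleTriv 𝔐₀ B φ S) {y : M₀} (hy : y ∈ t.baseSet) :
    ∀ᶠ z in 𝓝 y, z ∈ t.baseSet :=
  t.isOpen_baseSet.mem_nhds hy

/-- The subbundle with the given local trivializations. -/
noncomputable def bundle (hα : α ≤ 1) (hk : 1 ≤ k) (hl : l ≤ k) (hφ : 𝔐₀.IsRegularMap 𝔐 φ)
    (t : M₀ → SubbundleTriv 𝔐₀ B φ S) (ht : ∀ y, y ∈ (t y).baseSet) :
    BanachBundle 𝔐₀ l (fun y => S y) where
  ι := M₀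
  V a := (t a).W
  baseSet a := (t a).baseSet
  isOpen_baseSet a := (t a).isOpen_baseSet
  cover y := ⟨y, ht y⟩
  triv a y := (t a).triv y
  trivInv a y := (t a).trivInv y
  left_inv a y hy v := by
    refine Subtype.ext ?_
    rw [(t a).coe_trivInv hy]
    change B.trivInv _ _ ((t a).R y ((t a).Q y (B.triv _ _ v.1))) = _
    rw [(t a).R_Q y hy v v.2, B.left_inv _ _ ((t a).maps_baseSet y hy)]
  right_inv a y hy w := by
    change (t a).Q y (B.triv _ _ ((t a).trivInv y w : F (φ y))) = w
    rw [(t a).coe_trivInv hy, B.right_inv _ _ ((t a).maps_baseSet y hy), (t a).Q_R y hy]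
  compat a b y ha hb := by
    have h := (B.compat _ _ (φ y) ((t a).maps_baseSet y ha) ((t b).maps_baseSet y hb)).comp_map
      hα hk hl hφ
    -- The transition map is that of B, pulled back by φ, between R of the first trivialization and
    -- Q of the second.
    refine ((((t b).regQ y hb).clm_comp hα h).clm_comp hα ((t a).regR y ha)).congr ?_
    filter_upwards [(t a).eventually_mem ha] with z hz
    ext w
    change _ = (t b).Q z (B.triv _ _ ((t a).trivInv z w : F (φ z)))
    rw [(t a).coe_trivInv hz]
    rfl

section Morphisms

variable (hα : α ≤ 1) (hk : 1 ≤ k) (hl : l ≤ k) (hφ : 𝔐₀.IsRegularMap 𝔐 φ)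
  (t : M₀ → SubbundleTriv 𝔐₀ B φ S) (ht : ∀ y, y ∈ (t y).baseSet)
  {G : M → Type u} [∀ x, AddCommGroup (G x)] [∀ x, Module ℝ (G x)] [∀ x, TopologicalSpace (G x)]
  {B' : BanachBundle 𝔐 l G} {S' : ∀ y, Submodule ℝ (G (φ y))}
  (t' : M₀ → SubbundleTriv 𝔐₀ B' φ S') (ht' : ∀ y, y ∈ (t' y).baseSet)

theorem isMorphismOver_subtypeL :
    (bundle hα hk hl hφ t ht).IsMorphismOver B φ fun y => (S y).subtypeL := by
  intro a j y ha hj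
  have h := (B.compat _ j (φ y) ((t a).maps_baseSet y ha) hj).comp_map hα hk hl hφ
  refine (h.clm_comp hα ((t a).regR y ha)).congr ?_
  filter_upwards [(t a).eventually_mem ha] with z hz
  ext w
  change _ = B.triv _ _ ((t a).trivInv z w : F (φ z))
  rw [(t a).coe_trivInv hz]
  rfl

theorem isMorphism_restrict {T : ∀ x, F x →L[ℝ] G x} (hT : B.IsMorphism B' T)
    {T₀ : ∀ y, S y →L[ℝ] S' y} (hT₀ : ∀ y v, (T₀ y v : G (φ y)) = T (φ y) v) :
    (bundle hα hk hl hφ t ht).IsMorphism (bundle hα hk hl hφ t' ht') T₀ := by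
  intro a b y ha hb
  have h := (hT _ _ (φ y) ((t a).maps_baseSet y ha) ((t' b).maps_baseSet y hb)).comp_map hα hk hl hφ
  refine ((((t' b).regQ y hb).clm_comp hα h).clm_comp hα ((t a).regR y ha)).congr ?_
  filter_upwards [(t a).eventually_mem ha] with z hz
  ext w
  change _ = (t' b).Q z (B'.triv _ _ (T₀ z ((t a).trivInv z w) : G (φ z)))
  rw [hT₀, (t a).coe_trivInv hz]
  rfl

/-- Functionals are simply restricted, so the second factor contributes the transpose of its R and
no projection Q. -/
theorem isMorphismToDual_restrict {T : ∀ x, F x →L[ℝ] G x →L[ℝ] ℝ} (hT : B.IsMorphismToDual B' T)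
    {T₀ : ∀ y, S y →L[ℝ] S' y →L[ℝ] ℝ} (hT₀ : ∀ y v w, T₀ y v w = T (φ y) v w) :
    (bundle hα hk hl hφ t ht).IsMorphismToDual (bundle hα hk hl hφ t' ht') T₀ := by
  intro a b y ha hb
  have h := (hT _ _ (φ y) ((t a).maps_baseSet y ha) ((t' b).maps_baseSet y hb)).comp_map hα hk hl hφ
  refine (((((t' b).regR y hb).precomp hα).clm_comp hα h).clm_comp hα ((t a).regR y ha)).congr ?_
  filter_upwards [(t a).eventually_mem ha, (t' b).eventually_mem hb] with z hz hz'
  ext w w'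
  change _ = T₀ z ((t a).trivInv z w) ((t' b).trivInv z w')
  rw [hT₀, (t a).coe_trivInv hz, (t' b).coe_trivInv hz']
  rfl

end Morphisms

end SubbundleTriv

/-! ### Local triviality of kernels of split surjective bundle morphisms -/

section KernelBundle

variable {M : Type u} [TopologicalSpace M] {N : Type v} [TopologicalSpace N] {k l : ℕ∞}
  {α : ℝ≥0} {𝔐 : BanachManifold M k α} {𝔑 : BanachManifold N k α}
  {F : M → Type u} [∀ x, AddCommGroup (F x)] [∀ x, Module ℝ (F x)] [∀ x, TopologicalSpace (F x)]
  {K : N → Type v} [∀ x, AddCommGroup (K x)] [∀ x, Module ℝ (K x)] [∀ x, TopologicalSpace (K x)]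
  {B : BanachBundle 𝔐 l F} {B' : BanachBundle 𝔑 l K} {Φ : M → N} {y₀ : N}

/-- The kernels of a morphism over `Φ` are locally trivial over the level set of `Φ` around a point
at which the morphism has a right inverse. -/
theorem BanachBundle.IsMorphismOver.exists_subbundleTriv (hα : α ≤ 1) (hk : 1 ≤ k) (hl : l ≤ k)
    {a : ∀ x, F x →L[ℝ] K (Φ x)} (h : B.IsMorphismOver B' Φ a)
    {𝔐₀ : BanachManifold {x : M // Φ x = y₀} k α} (hφ : 𝔐₀.IsRegularMap 𝔐 Subtype.val)
    (x₀ : {x : M // Φ x = y₀}) (b : K (Φ x₀) →L[ℝ] F x₀) (hb : ∀ w, a x₀ (b w) = w) :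
    ∃ t : SubbundleTriv 𝔐₀ B Subtype.val (fun y => LinearMap.ker (a y.1).toLinearMap),
      x₀ ∈ t.baseSet := by
  obtain ⟨i, hi⟩ := B.cover x₀
  obtain ⟨j, hj⟩ := B'.cover y₀
  have hj' (y : {x : M // Φ x = y₀}) : Φ y ∈ B'.baseSet j := by rwa [y.2]
  let A : {x : M // Φ x = y₀} → B.V i →L[ℝ] B'.V j := fun y =>
    ((B'.triv j (Φ y)).comp (a y)).comp (B.trivInv i y)
  have hA (y : {x : M // Φ x = y₀}) (hy : y.1 ∈ B.baseSet i) : 𝔐₀.RegAt l A y :=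
    (h i j y hy (hj' y)).comp_map hα hk hl hφ
  have hAv (y : {x : M // Φ x = y₀}) (v : F y) (hy : y.1 ∈ B.baseSet i) :
      A y (B.triv i y v) = B'.triv j (Φ y) (a y v) := by
    change B'.triv j (Φ y) (a y (B.trivInv i y (B.triv i y v))) = _
    rw [B.left_inv i y hy]
  let b₀ : B'.V j →L[ℝ] B.V i := ((B.triv i x₀).comp b).comp (B'.trivInv j (Φ x₀))
  have hb₀ (w) : A x₀ (b₀ w) = w := by
    change A x₀ (B.triv i x₀ (b (B'.trivInv j (Φ x₀) w))) = w
    rw [hAv x₀ _ hi, hb, B'.right_inv j _ (hj' x₀)]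
  -- This operator is the identity at x₀ and satisfies A(x₀) g(y) = A(y); where it is invertible, it
  -- maps ker A(y) onto the fixed space ker A(x₀).
  let g : {x : M // Φ x = y₀} → B.V i →L[ℝ] B.V i := fun y =>
    ContinuousLinearMap.id ℝ _ + b₀.comp (A y - A x₀)
  have hg (y : {x : M // Φ x = y₀}) (hy : y.1 ∈ B.baseSet i) : 𝔐₀.RegAt l g y :=
    (BanachManifold.RegAt.const hα _).add hα ((BanachManifold.RegAt.const hα b₀).clm_comp hα
      ((hA y hy).sub hα (BanachManifold.RegAt.const hα (A x₀))))
  have hAg (y v) : A x₀ (g y v) = A y v := by simp [g, hb₀]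
  let P := kerProj (A x₀) b₀ fun v => hb₀ (A x₀ v)
  refine ⟨{
    i := i
    W := LinearMap.ker (A x₀).toLinearMap
    baseSet := {y | y.1 ∈ B.baseSet i ∧ (g y).IsInvertible}
    isOpen_baseSet := ?_
    maps_baseSet := fun y hy => hy.1
    Q := fun y => P.comp (g y)
    R := fun y => (g y).inverse.comp (Submodule.subtypeL _)
    regQ := fun y hy => (BanachManifold.RegAt.const hα P).clm_comp hα (hg y hy.1)
    regR := fun y hy => ((hg y hy.1).inverse hα hy.2).clm_comp hα
      (BanachManifold.RegAt.const hα _)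
    mem := fun y hy w => ?_
    Q_R := fun y hy w => ?_
    R_Q := fun y hy v hv => ?_ }, ?_⟩
  · refine isOpen_iff_mem_nhds.2 fun y hy => ?_
    have h1 : ∀ᶠ z : {x : M // Φ x = y₀} in 𝓝 y, z.1 ∈ B.baseSet i :=
      ((B.isOpen_baseSet i).preimage continuous_subtype_val).mem_nhds hy.1
    have h2 : ∀ᶠ z in 𝓝 y, (g z).IsInvertible := by
      obtain ⟨e, he⟩ := hy.2
      have hn : range ((↑) : (B.V i ≃L[ℝ] B.V i) → B.V i →L[ℝ] B.V i) ∈ 𝓝 (g y) := by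
        rw [← he]
        exact e.nhds
      exact (hg y hy.1).continuousAt hn
    exact h1.and h2
  · have h1 : A y ((g y).inverse w) = 0 := by
      rw [← hAg, hy.2.self_apply_inverse]
      exact w.2
    change a y (B.trivInv i y ((g y).inverse w)) = 0
    rw [← B'.left_inv j _ (hj' y) (a y _)]
    change B'.trivInv j (Φ y) (A y ((g y).inverse w)) = 0
    rw [h1, map_zero]
  · change P (g y ((g y).inverse w)) = w
    rw [hy.2.self_apply_inverse]
    exact kerProj_coe _ w
  · change (g y).inverse (P (g y (B.triv i y v)) : B.V i) = B.triv i y v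
    have hv' : a y v = 0 := hv
    rw [coe_kerProj_of_mem _ (by rw [hAg, hAv y v hy.1, hv', map_zero]), hy.2.inverse_apply_self]
  · refine ⟨hi, ContinuousLinearEquiv.refl ℝ _, ?_⟩
    ext; simp [g]

end KernelBundle

/-! ### Level sets of para-Riemannian morphisms -/

/-- Surjectivity cancels the right factor A in A B A = A. -/
theorem ParaHilbertMor.IsPseudoinverse.right_inv {X₁ H₁ Y₁ X₂ H₂ Y₂ : Type*}
    [AddCommGroup X₁] [Module ℝ X₁] [TopologicalSpace X₁]
    [AddCommGroup H₁] [Module ℝ H₁] [TopologicalSpace H₁]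
    [AddCommGroup Y₁] [Module ℝ Y₁] [TopologicalSpace Y₁]
    [AddCommGroup X₂] [Module ℝ X₂] [TopologicalSpace X₂]
    [AddCommGroup H₂] [Module ℝ H₂] [TopologicalSpace H₂]
    [AddCommGroup Y₂] [Module ℝ Y₂] [TopologicalSpace Y₂]
    {E₁ : ParaHilbertSpace X₁ H₁ Y₁} {E₂ : ParaHilbertSpace X₂ H₂ Y₂} {A : ParaHilbertMor E₁ E₂}
    {B : ParaHilbertMor E₂ E₁} (h : A.IsPseudoinverse B) (hA : A.IsSurjective) :
    (∀ u, A.X (B.X u) = u) ∧ (∀ v, A.H (B.H v) = v) ∧ ∀ w, A.Y (B.Y w) = w := by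
  obtain ⟨⟨hX, -, hH, -, hY, -⟩, -⟩ := h
  exact ⟨hA.1.forall.2 hX, hA.2.1.forall.2 hH, hA.2.2.forall.2 hY⟩

namespace ParaRiemannianMor

variable {M₁ : Type u} [TopologicalSpace M₁] {M₂ : Type v} [TopologicalSpace M₂]
  {k : ℕ∞} {α : ℝ≥0} {X₁ H₁ Y₁ : M₁ → Type u} {X₂ H₂ Y₂ : M₂ → Type v}
  [∀ x, AddCommGroup (X₁ x)] [∀ x, Module ℝ (X₁ x)] [∀ x, TopologicalSpace (X₁ x)]
  [∀ x, AddCommGroup (H₁ x)] [∀ x, Module ℝ (H₁ x)] [∀ x, TopologicalSpace (H₁ x)]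
  [∀ x, AddCommGroup (Y₁ x)] [∀ x, Module ℝ (Y₁ x)] [∀ x, TopologicalSpace (Y₁ x)]
  [∀ x, AddCommGroup (X₂ x)] [∀ x, Module ℝ (X₂ x)] [∀ x, TopologicalSpace (X₂ x)]
  [∀ x, AddCommGroup (H₂ x)] [∀ x, Module ℝ (H₂ x)] [∀ x, TopologicalSpace (H₂ x)]
  [∀ x, AddCommGroup (Y₂ x)] [∀ x, Module ℝ (Y₂ x)] [∀ x, TopologicalSpace (Y₂ x)]
  {P₁ : ParaRiemannianManifold M₁ k α X₁ H₁ Y₁} {P₂ : ParaRiemannianManifold M₂ k α X₂ H₂ Y₂}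
  {Φ : M₁ → M₂} (A : ParaRiemannianMor P₁ P₂ Φ) {y₀ : M₂}

theorem exists_levelChart (hk : 1 ≤ k) (hα : α ≤ 1) (x : {x : M₁ // Φ x = y₀})
    {b : X₂ (Φ x) →L[ℝ] X₁ x} (hb : ∀ u, (A.mor x).X (b u) = u) :
    ∃ c : LevelChart P₁.mfd P₂.mfd Φ y₀, x.1 ∈ c.ψ.source := by
  obtain ⟨x, rfl⟩ := x
  obtain ⟨e, he⟩ := P₁.mfd.cover x
  obtain ⟨d, hd⟩ := P₂.mfd.cover (Φ x)
  refine A.regular.exists_levelChart hk hα he hd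
    ((P₁.mfd.dchart e x).comp (((P₁.τ x : X₁ x →L[ℝ] P₁.mfd.TangentSpace x).comp b).comp
      (((P₂.τ (Φ x)).symm : P₂.mfd.TangentSpace (Φ x) →L[ℝ] X₂ (Φ x)).comp
        ((P₂.mfd.tangentEquiv hk hd).symm : P₂.mfd.V d →L[ℝ] P₂.mfd.TangentSpace (Φ x)))))
    fun w => ?_
  refine (A.tangent x _ e d he hd).trans ?_
  have hb' (u) : (A.mor x).X (b u) = u := hb u
  simp [hb', P₂.mfd.dchart_tangentEquiv_symm hk hd]

variable (c : LevelChart P₁.mfd P₂.mfd Φ y₀)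

/-- At every point of the domain of ψ, T represents the tangent map of Φ. This identifies ker T with
the kernel of that map. -/
theorem T_dψ_τ (hk : 1 ≤ k) {x : M₁} (hx : x ∈ c.ψ.source) (u : X₁ x) :
    c.T (c.dψ x (P₁.τ x u)) = P₂.mfd.dchart c.d (Φ x) (P₂.τ (Φ x) ((A.mor x).X u)) := by
  rw [c.T_dψ hk hx]
  exact A.tangent x u _ _ (c.source_subset hx) (c.maps_source x hx)

theorem T_dψ_ker (hk : 1 ≤ k) {x : M₁} (hx : x ∈ c.ψ.source)
    (u : LinearMap.ker (A.mor x).X.toLinearMap) : c.T (c.dψ x (P₁.τ x u)) = 0 := by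
  have : (A.mor x).X u = 0 := u.2
  rw [A.T_dψ_τ c hk hx, this, map_zero, map_zero]

/-- In a straightening chart, the differential maps the kernel of the tangent map of `Φ`
isomorphically onto the model space of the level set. -/
noncomputable def kerTangentEquiv (hk : 1 ≤ k) (hα : α ≤ 1) {x : M₁} (hx : x ∈ c.ψ.source) :
    LinearMap.ker (A.mor x).X.toLinearMap ≃L[ℝ] LinearMap.ker c.T.toLinearMap :=
  ContinuousLinearEquiv.equivOfInverse
    (c.P.comp ((c.dψ x).comp ((P₁.τ x : X₁ x →L[ℝ] P₁.mfd.TangentSpace x).comp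
      (Submodule.subtypeL _))))
    ((((P₁.τ x).symm : P₁.mfd.TangentSpace x →L[ℝ] X₁ x).comp
      (((c.dψEquiv hk hα hx).symm : P₁.mfd.V c.e →L[ℝ] P₁.mfd.TangentSpace x).comp
        (Submodule.subtypeL _))).codRestrict _ fun w => by
          change (A.mor x).X ((P₁.τ x).symm ((c.dψEquiv hk hα hx).symm w)) = 0
          have h := A.T_dψ_τ c hk hx ((P₁.τ x).symm ((c.dψEquiv hk hα hx).symm w))
          rw [ContinuousLinearEquiv.apply_symm_apply, ← c.dψEquiv_apply hk hα hx,
            ContinuousLinearEquiv.apply_symm_apply] at h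
          have hw : c.T w = 0 := w.2
          rw [hw, ← map_zero (P₂.mfd.dchart c.d (Φ x))] at h
          have h' := P₂.mfd.dchart_injective (c.maps_source x hx) h
          rw [← map_zero (P₂.τ (Φ x))] at h'
          exact ((P₂.τ (Φ x)).injective h').symm)
    (fun u => Subtype.ext <| by
      change (P₁.τ x).symm ((c.dψEquiv hk hα hx).symm (c.P (c.dψ x (P₁.τ x u)) : P₁.mfd.V c.e)) = u
      rw [c.coe_P (A.T_dψ_ker c hk hx u), ← c.dψEquiv_apply hk hα hx]
      simp)
    (fun w => Subtype.ext <| by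
      change (c.P (c.dψ x (P₁.τ x ((P₁.τ x).symm ((c.dψEquiv hk hα hx).symm w)))) : P₁.mfd.V c.e) = w
      rw [ContinuousLinearEquiv.apply_symm_apply, ← c.dψEquiv_apply hk hα hx,
        ContinuousLinearEquiv.apply_symm_apply]
      exact c.coe_P w.2)

section LevelSet

variable (hk : 1 ≤ k) (hα : α ≤ 1) (c : {x : M₁ // Φ x = y₀} → LevelChart P₁.mfd P₂.mfd Φ y₀)
  (hc : ∀ x, x.1 ∈ (c x).ψ.source)

/-- The kernel of the tangent map of `Φ` is the tangent space of the level set. -/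
noncomputable def levelSetτ (x : {x : M₁ // Φ x = y₀}) :
    LinearMap.ker (A.mor x.1).X.toLinearMap ≃L[ℝ] (LevelChart.levelSet hk hα c hc).TangentSpace x :=
  (A.kerTangentEquiv (c x) hk hα (hc x)).trans
    (LevelChart.tangentEquivKer hk hα c hc (hc x)).symm

/-- The isomorphism was defined with the chart chosen at x; the same formula holds in every other
chart a around x. -/
theorem dchart_levelSetτ {x a : {x : M₁ // Φ x = y₀}} (ha : x.1 ∈ (c a).ψ.source)
    (u : LinearMap.ker (A.mor x.1).X.toLinearMap) :
    (LevelChart.levelSet hk hα c hc).dchart a x (A.levelSetτ hk hα c hc x u) =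
      (c a).P ((c a).dψ x (P₁.τ x u)) :=
  LevelChart.dchart_levelSet hk hα c hc (hc x) ha (P₁.τ x u) (A.T_dψ_ker (c x) hk (hc x) u)
    (LevelChart.dchart_tangentEquivKer_symm hk hα c hc (hc x) _)

/-- Locally the map is the product of P, the derivative of ψ, the local representation of the
original τ and R, all of which are regular. -/
theorem isMorphismToTangent_levelSetτ
    (t : ∀ _ : {x : M₁ // Φ x = y₀}, SubbundleTriv (LevelChart.levelSet hk hα c hc) P₁.E.bX
      Subtype.val fun y => LinearMap.ker (A.mor y.1).X.toLinearMap)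
    (ht : ∀ y, y ∈ (t y).baseSet) :
    (SubbundleTriv.bundle hα hk tsub_le_self (LevelChart.isRegularMap_val hk hα c hc) t ht
      ).IsMorphismToTangent fun x => (A.levelSetτ hk hα c hc x :
        LinearMap.ker (A.mor x.1).X.toLinearMap →L[ℝ]
          (LevelChart.levelSet hk hα c hc).TangentSpace x) := by
  intro a b y ha hb
  have hφ := LevelChart.isRegularMap_val hk hα c hc
  have hb' : y.1 ∈ (c b).ψ.source := hb
  have h1 := ((c b).regAt_fderiv hk hα hb').comp_map hα hk tsub_le_self hφ
  have h2 := (P₁.regular_τ _ _ y.1 ((t a).maps_baseSet y ha) ((c b).source_subset hb')).comp_map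
    hα hk tsub_le_self hφ
  refine (((BanachManifold.RegAt.const hα (c b).P).clm_comp hα h1).clm_comp hα
    (h2.clm_comp hα ((t a).regR y ha))).congr ?_
  have hbn : ∀ᶠ z : {x : M₁ // Φ x = y₀} in 𝓝 y, z.1 ∈ (c b).ψ.source :=
    ((c b).ψ.open_source.preimage continuous_subtype_val).mem_nhds hb'
  filter_upwards [(t a).eventually_mem ha, hbn] with z hz hz'
  ext1 w
  refine Eq.trans ?_ (A.dchart_levelSetτ hk hα c hc hz' ((t a).trivInv z w)).symm
  rw [(t a).coe_trivInv hz]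
  rfl

end LevelSet

end ParaRiemannianMor

theorem mainTheorem5 {M₁ : Type u} [TopologicalSpace M₁] {M₂ : Type v} [TopologicalSpace M₂]
    {X₁ H₁ Y₁ : M₁ → Type u} {X₂ H₂ Y₂ : M₂ → Type v}
    [∀ x, AddCommGroup (X₁ x)] [∀ x, Module ℝ (X₁ x)] [∀ x, TopologicalSpace (X₁ x)]
    [∀ x, AddCommGroup (H₁ x)] [∀ x, Module ℝ (H₁ x)] [∀ x, TopologicalSpace (H₁ x)]
    [∀ x, AddCommGroup (Y₁ x)] [∀ x, Module ℝ (Y₁ x)] [∀ x, TopologicalSpace (Y₁ x)]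
    [∀ x, AddCommGroup (X₂ x)] [∀ x, Module ℝ (X₂ x)] [∀ x, TopologicalSpace (X₂ x)]
    [∀ x, AddCommGroup (H₂ x)] [∀ x, Module ℝ (H₂ x)] [∀ x, TopologicalSpace (H₂ x)]
    [∀ x, AddCommGroup (Y₂ x)] [∀ x, Module ℝ (Y₂ x)] [∀ x, TopologicalSpace (Y₂ x)]
    (k : ℕ∞) (hk : 1 ≤ k) (α : ℝ≥0) (hα : α ≤ 1)
    (P₁ : ParaRiemannianManifold M₁ k α X₁ H₁ Y₁) (P₂ : ParaRiemannianManifold M₂ k α X₂ H₂ Y₂)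
    (Φ : M₁ → M₂) (A : ParaRiemannianMor P₁ P₂ Φ) (y₀ : M₂)
    (hsurj : ∀ x, Φ x = y₀ → (A.mor x).IsSurjective)
    (hpinv : ∀ x, Φ x = y₀ → ∃ B, (A.mor x).IsPseudoinverse B) :
    ∃ P₀ : ParaRiemannianManifold {x : M₁ // Φ x = y₀} k α
        (fun x => LinearMap.ker (A.mor x.1).X.toLinearMap)
        (fun x => LinearMap.ker (A.mor x.1).H.toLinearMap)
        (fun x => LinearMap.ker (A.mor x.1).Y.toLinearMap),
      (∀ x v₁ v₂, (P₀.E.fib x).I v₁ v₂ = (P₁.E.fib x.1).I v₁.1 v₂.1) ∧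
      (∀ x u w, (P₀.E.fib x).J u w = (P₁.E.fib x.1).J u.1 w.1) ∧
      ∃ C : ParaRiemannianMor P₀ P₁ Subtype.val, ∀ x,
        (C.mor x).X = (LinearMap.ker (A.mor x.1).X.toLinearMap).subtypeL ∧
        (C.mor x).H = (LinearMap.ker (A.mor x.1).H.toLinearMap).subtypeL ∧
        (C.mor x).Y = (LinearMap.ker (A.mor x.1).Y.toLinearMap).subtypeL := by
  have hB (x : {x : M₁ // Φ x = y₀}) : ∃ B, (A.mor x.1).IsPseudoinverse B := hpinv x.1 x.2
  -- The choice is pointwise; no regularity of B in x is required.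
  choose B hB' using hB
  have hr (x) := (hB' x).right_inv (hsurj x.1 x.2)
  choose c hc using fun x => A.exists_levelChart hk hα x (hr x).1
  have hφ := LevelChart.isRegularMap_val hk hα c hc
  have hl : k - 1 ≤ k := tsub_le_self
  choose tX htX using fun x =>
    A.regular_X.exists_subbundleTriv hα hk hl hφ x (B x).X (hr x).1
  choose tH htH using fun x =>
    A.regular_H.exists_subbundleTriv hα hk hl hφ x (B x).H (hr x).2.1
  choose tY htY using fun x =>
    A.regular_Y.exists_subbundleTriv hα hk hl hφ x (B x).Y (hr x).2.2
  have := P₁.E.bX.isTopologicalAddGroup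
  have := P₁.E.bH.isTopologicalAddGroup
  have := P₁.E.bY.isTopologicalAddGroup
  refine ⟨{
    mfd := LevelChart.levelSet hk hα c hc
    E := {
      bX := SubbundleTriv.bundle hα hk hl hφ tX htX
      bH := SubbundleTriv.bundle hα hk hl hφ tH htH
      bY := SubbundleTriv.bundle hα hk hl hφ tY htY
      fib := fun x => (A.mor x.1).ker ⟨B x, hB' x⟩
      regular_i := SubbundleTriv.isMorphism_restrict hα hk hl hφ tX htX tH htH
        P₁.E.regular_i fun _ _ => rfl
      regular_j := SubbundleTriv.isMorphism_restrict hα hk hl hφ tH htH tY htY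
        P₁.E.regular_j fun _ _ => rfl
      regular_I := SubbundleTriv.isMorphismToDual_restrict hα hk hl hφ tH htH tH htH
        P₁.E.regular_I fun _ _ _ => rfl
      regular_J := SubbundleTriv.isMorphismToDual_restrict hα hk hl hφ tX htX tY htY
        P₁.E.regular_J fun _ _ _ => rfl }
    τ := A.levelSetτ hk hα c hc
    regular_τ := A.isMorphismToTangent_levelSetτ hk hα c hc tX htX },
    fun _ _ _ => rfl, fun _ _ _ => rfl, {
      regular := hφ
      mor := fun x => {
        X := Submodule.subtypeL _
        H := Submodule.subtypeL _
        Y := Submodule.subtypeL _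
        comm_i := fun _ => rfl
        comm_j := fun _ => rfl }
      regular_X := SubbundleTriv.isMorphismOver_subtypeL hα hk hl hφ tX htX
      regular_H := SubbundleTriv.isMorphismOver_subtypeL hα hk hl hφ tH htH
      regular_Y := SubbundleTriv.isMorphismOver_subtypeL hα hk hl hφ tY htY
      tangent := fun x u => LevelChart.isTangentImage_val hk hα c hc (P₁.τ x u)
        (fun a ha => A.T_dψ_ker (c a) hk ha u) fun a ha => A.dchart_levelSetτ hk hα c hc ha u },
    fun _ => ⟨rfl, rfl, rfl⟩⟩
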